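/- Conventions. All Hilbert spaces are finite-dimensional and $\log$ is the natural logarithm. Functions of Hermitian operators are evaluated on the support: if $A=\sum_{i:a_i\neq 0}a_i|i\rangle\langle i|$ is an eigendecomposition, then $\operatorname{supp}(A)=\operatorname{span}\{|i\rangle : a_i\neq 0\}$ and $f(A)=\sum_{i:a_i\neq 0}f(a_i)|i\rangle\langle i|$; in particular $A^0$ is the projection onto $\operatorname{supp}(A)$. A quantum channel is a completely positive trace-preserving linear map. For positive semi-definite $\rho,\sigma$ put $$D(\rho\|\sigma)=\operatorname{Tr}\{\rho[\log\rho-\log\sigma]\},\qquad D_2(\rho\|\sigma)=\log\operatorname{Tr}\{\rho^2\sigma^{-1}\},\qquad D_{\max}(\rho\|\sigma)=\log\|\sigma^{-1/2}\rho\,\sigma^{-1/2}\|_\infty$$ if $\operatorname{supp}(\rho)\subseteq\operatorname{supp}(\sigma)$, where $\|\cdot\|_\infty$ is the operator norm, and let these three quantities be $+\infty$ otherwise. Put $D_0(\rho\|\sigma)=-\log\operatorname{Tr}\{\rho^0\sigma\}$ (equal to $+\infty$ if the trace vanishes) and $F(\rho,\sigma)=\|\sqrt\rho\sqrt\sigma\|_1^2$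 with $\|A\|_1=\operatorname{Tr}\sqrt{A^\dagger A}$. For a linear map $\mathcal N$ with Hilbert–Schmidt adjoint $\mathcal N^\dagger$, and unitaries $V$ commuting with $\mathcal N(\sigma)$ and $W$ commuting with $\sigma$, the swiveled Petz recovery map is $$\mathcal R^{V,W}_{\sigma,\mathcal N}(X)=W\sigma^{1/2}\,\mathcal N^\dagger\!\left(\mathcal N(\sigma)^{-1/2}\,V X V^\dagger\,\mathcal N(\sigma)^{-1/2}\right)\sigma^{1/2}W^\dagger .$$ All maxima and minima below are over all such pairs $(V,W)$, and they are attained. Statement. (i) Let $\rho$ be a density operator on $\mathcal H$, $\sigma\neq0$ a positive semi-definite operator on $\mathcal H$, and $\mathcal N$ a quantum channel from operators on $\mathcal H$ to operators on $\mathcal K$, with $\operatorname{supp}(\rho)\subseteq\operatorname{supp}(\sigma)$. Then $$-\log\max_{V,W}F\bigl(\rho,\mathcal R^{V,W}_{\sigma,\mathcal N}(\mathcal N(\rho))\bigr)\le D(\rho\|\sigma)-D(\mathcal N(\rho)\|\mathcal N(\sigma)),$$ $$\min_{V,W}D_0\bigl(\rho\,\big\|\,\mathcal R^{V,W}_{\sigma,\mathcal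 N}(\mathcal N(\rho))\bigr)\le D(\rho\|\sigma)-D(\mathcal N(\rho)\|\mathcal N(\sigma)).$$ (ii) Let $\rho$ be a positive definite density operator and $\sigma$ a positive definite operator on $\mathcal H_S\otimes\mathcal H_{E'}$, and let $\mathcal N(\theta)=\operatorname{Tr}_E\{U\theta U^\dagger\}$, where $U$ is a unitary operator from $\mathcal H_S\otimes\mathcal H_{E'}$ onto an isomorphic tensor-product space $\mathcal H_B\otimes\mathcal H_E$, such that $\mathcal N(\rho)$ and $\mathcal N(\sigma)$ are positive definite on $\mathcal H_B$. Then $$D(\rho\|\sigma)-D(\mathcal N(\rho)\|\mathcal N(\sigma))\le\max_{V,W}D_{\max}\bigl(\rho\,\big\|\,\mathcal R^{V,W}_{\sigma,\mathcal N}(\mathcal N(\rho))\bigr),$$ $$D(\rho\|\sigma)-D(\mathcal N(\rho)\|\mathcal N(\sigma))\le\max_{V,W}D_{2}\bigl(\rho\,\big\|\,\mathcal R^{V,W}_{\sigma,\mathcal N}(\mathcal N(\rho))\bigr).$$ -/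

import Mathlib

open scoped ComplexOrder

namespace SwiveledRenyi

/-- The support of a Hermitian operator: the span of its eigenvectors with non-zero eigenvalue. -/
def suppSpace {n : Type*} [Fintype n] (A : Matrix n n ℂ) : Submodule ℂ (n → ℂ) :=
  Submodule.span ℂ {v | ∃ a : ℂ, a ≠ 0 ∧ A.mulVec v = a • v}

/-- The function `f` of a Hermitian operator evaluated on its support:
`f(A) = ∑_{i : a_i ≠ 0} f(a_i) |i⟩⟨i|`. -/
noncomputable def funOnSupp {n : Type*} [Fintype n] [DecidableEq n] (f : ℝ → ℝ)
    (A : Matrix n n ℂ) : Matrix n n ℂ :=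
  cfc (fun x : ℝ => if x = 0 then 0 else f x) A

/-- Real powers on the support. In particular `powOnSupp 0 A` is the support projection. -/
noncomputable def powOnSupp {n : Type*} [Fintype n] [DecidableEq n] (r : ℝ)
    (A : Matrix n n ℂ) : Matrix n n ℂ :=
  funOnSupp (fun x => x ^ r) A

/-- The (natural) logarithm on the support. -/
noncomputable def logOnSupp {n : Type*} [Fintype n] [DecidableEq n]
    (A : Matrix n n ℂ) : Matrix n n ℂ :=
  funOnSupp Real.log A

/-- A density operator. -/
def IsDensity {n : Type*} [Fintype n] (ρ : Matrix n n ℂ) : Prop :=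
  ρ.PosSemidef ∧ ρ.trace = 1

/-- A quantum channel: a completely positive trace-preserving linear map. Complete positivity says
that `id ⊗ N` maps positive semi-definite operators on `ℂ^k ⊗ H` to positive semi-definite ones,
for every `k`. -/
structure IsChannel {n m : Type*} [Fintype n] [Fintype m]
    (N : Matrix n n ℂ →ₗ[ℂ] Matrix m m ℂ) : Prop where
  trace_preserving : ∀ X, (N X).trace = X.trace
  completely_positive : ∀ (k : ℕ) (X : Matrix (Fin k × n) (Fin k × n) ℂ), X.PosSemidef →
    (Matrix.of fun p q : Fin k × m =>
      N (Matrix.of fun i j => X (p.1, i) (q.1, j)) p.2 q.2).PosSemidef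

/-- The adjoint of `N` for the Hilbert-Schmidt inner product. -/
def adjointMap {n m : Type*} [Fintype m] [DecidableEq n]
    (N : Matrix n n ℂ →ₗ[ℂ] Matrix m m ℂ) (Y : Matrix m m ℂ) : Matrix n n ℂ :=
  Matrix.of fun i j => ((N (Matrix.single i j 1)).conjTranspose * Y).trace

/-- The defining property of the adjoint. -/
theorem trace_adjointMap {n m : Type*} [Fintype n] [Fintype m] [DecidableEq n]
    (N : Matrix n n ℂ →ₗ[ℂ] Matrix m m ℂ) (X : Matrix n n ℂ) (Y : Matrix m m ℂ) :
    (X.conjTranspose * adjointMap N Y).trace = ((N X).conjTranspose * Y).trace := by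
  have hX : X = ∑ i, ∑ j, X i j • Matrix.single i j (1 : ℂ) := by
    conv_lhs => rw [Matrix.matrix_eq_sum_single X]
    simp [Matrix.smul_single]
  conv_rhs => rw [hX]
  simp only [map_sum, map_smul, Matrix.conjTranspose_sum, Matrix.conjTranspose_smul,
    Finset.sum_mul, Matrix.trace_sum, Matrix.smul_mul, Matrix.trace_smul]
  rw [Finset.sum_comm]
  simp [Matrix.trace, Matrix.mul_apply, adjointMap]

/-- The quantum relative entropy, `+∞` unless `supp ρ ⊆ supp σ`. -/
noncomputable def relEntropy {n : Type*} [Fintype n] [DecidableEq n]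
    (ρ σ : Matrix n n ℂ) : EReal :=
  open Classical in
  if suppSpace ρ ≤ suppSpace σ then
    (((ρ * (logOnSupp ρ - logOnSupp σ)).trace.re : ℝ) : EReal) else ⊤

/-- The trace norm `‖A‖₁ = Tr √(A†A)`. -/
noncomputable def traceNorm {n : Type*} [Fintype n] [DecidableEq n] (A : Matrix n n ℂ) : ℝ :=
  (powOnSupp (1 / 2) (A.conjTranspose * A)).trace.re

/-- The quantum fidelity `F(ρ, σ) = ‖√ρ √σ‖₁²`. -/
noncomputable def fidelity {n : Type*} [Fintype n] [DecidableEq n] (ρ σ : Matrix n n ℂ) : ℝ :=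
  traceNorm (powOnSupp (1 / 2) ρ * powOnSupp (1 / 2) σ) ^ 2

/-- The natural logarithm of a non-negative real, with `log 0 = -∞`. -/
noncomputable def elog (x : ℝ) : EReal := ENNReal.log (ENNReal.ofReal x)

/-- The zero-relative entropy `D₀(ρ‖σ) = -log Tr{ρ⁰ σ}`. -/
noncomputable def relEntropyZero {n : Type*} [Fintype n] [DecidableEq n]
    (ρ σ : Matrix n n ℂ) : EReal :=
  -elog (powOnSupp 0 ρ * σ).trace.re

/-- The collision relative entropy `D₂(ρ‖σ) = log Tr{ρ² σ⁻¹}`, `+∞` unless `supp ρ ⊆ supp σ`. -/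
noncomputable def relEntropyTwo {n : Type*} [Fintype n] [DecidableEq n]
    (ρ σ : Matrix n n ℂ) : EReal :=
  open Classical in
  if suppSpace ρ ≤ suppSpace σ then elog (ρ ^ 2 * powOnSupp (-1) σ).trace.re else ⊤

/-- The max-relative entropy `D_max(ρ‖σ) = log ‖σ^{-1/2} ρ σ^{-1/2}‖` (operator norm on the
Euclidean space), `+∞` unless `supp ρ ⊆ supp σ`. -/
noncomputable def relEntropyMax {n : Type*} [Fintype n] [DecidableEq n]
    (ρ σ : Matrix n n ℂ) : EReal :=
  open Classical in
  if suppSpace ρ ≤ suppSpace σ then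
    elog ‖Matrix.toEuclideanCLM (n := n) (𝕜 := ℂ)
      (powOnSupp (-1 / 2) σ * ρ * powOnSupp (-1 / 2) σ)‖ else ⊤

/-- The set of all unitaries that commute with `ω`. -/
def commutingUnitaries {n : Type*} [Fintype n] [DecidableEq n] (ω : Matrix n n ℂ) :
    Set (Matrix n n ℂ) :=
  {V | V ∈ Matrix.unitaryGroup n ℂ ∧ Commute V ω}

/-- The Petz recovery map
`X ↦ σ^{1/2} N†(N(σ)^{-1/2} X N(σ)^{-1/2}) σ^{1/2}`. -/
noncomputable def petzMap {n m : Type*} [Fintype n] [Fintype m] [DecidableEq n] [DecidableEq m]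
    (σ : Matrix n n ℂ) (N : Matrix n n ℂ →ₗ[ℂ] Matrix m m ℂ) (X : Matrix m m ℂ) : Matrix n n ℂ :=
  powOnSupp (1 / 2) σ *
    adjointMap N (powOnSupp (-1 / 2) (N σ) * X * powOnSupp (-1 / 2) (N σ)) *
    powOnSupp (1 / 2) σ

/-- The swiveled Petz recovery map `X ↦ W P(V X V†) W†`. -/
noncomputable def swiveledPetzMap {n m : Type*} [Fintype n] [Fintype m] [DecidableEq n]
    [DecidableEq m] (σ : Matrix n n ℂ) (N : Matrix n n ℂ →ₗ[ℂ] Matrix m m ℂ)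
    (V : Matrix m m ℂ) (W : Matrix n n ℂ) (X : Matrix m m ℂ) : Matrix n n ℂ :=
  W * petzMap σ N (V * X * V.conjTranspose) * W.conjTranspose

/-- The values of `d(ρ, R^{V,W}(N(ρ)))`, where `V` and `W` run over the unitaries that commute
with `N(σ)` and with `σ`. -/
def swivelValues {n m : Type*} [Fintype n] [Fintype m] [DecidableEq n] [DecidableEq m]
    {α : Type*} (d : Matrix n n ℂ → Matrix n n ℂ → α) (ρ σ : Matrix n n ℂ)
    (N : Matrix n n ℂ →ₗ[ℂ] Matrix m m ℂ) : Set α :=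
  {x | ∃ V ∈ commutingUnitaries (N σ), ∃ W ∈ commutingUnitaries σ,
    x = d ρ (swiveledPetzMap σ N V W (N ρ))}

/-- The map `θ ↦ Tr_E {U θ U†}`, for `U` from `H` to `H_B ⊗ H_E`. -/
def dilationMap {h b e : Type*} [Fintype h] [Fintype e] (U : Matrix (b × e) h ℂ) :
    Matrix h h ℂ →ₗ[ℂ] Matrix b b ℂ where
  toFun θ := Matrix.of fun i j => ∑ k, (U * θ * U.conjTranspose) (i, k) (j, k)
  map_add' θ η := by
    ext i j
    simp [Matrix.mul_add, Matrix.add_mul, Finset.sum_add_distrib]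
  map_smul' c θ := by
    ext i j
    simp [Finset.mul_sum]

end SwiveledRenyi

open SwiveledRenyi

namespace SwiveledRenyi

/-! The proof is complex interpolation. By Stinespring, `N` is `dilationMap U` for an isometry `U`.
Consider the entire function f(z) = Tr{ρ · ρ^{-z/2} U†(N(ρ)^{z/2} N(σ)^{-z/2} ⊗ 1)U σ^{z/2}}
(`swivelFun`). It satisfies f(0) = Tr ρ = 1, and f'(0) is -1/2 times the drop of relative entropy
(`hasDerivAt_swivelFun_zero`). On the imaginary axis all powers are unitary, so |f| ≤ 1. Hadamard's
three lines theorem, with |f| ≤ b on Re z = 1, gives |f(x)| ≤ b^x; comparing slopes at 0 yields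
exp(Re f'(0)) ≤ b (`exp_deriv_le_of_three_lines`).

At z = 1 + 2u with u imaginary, the phases N(σ)^u and σ^{-u} are exactly swivels V and W, and f(z) =
Tr{√ρ · (co-isometry) · B} with B†B the recovered state (`swivelFun_one_add`). Polar decomposition
bounds |f|² by the fidelity, and Cauchy–Schwarz bounds it by Tr{ρ⁰ R}; this is (i). For (ii) the
same argument runs on f(-z): on Re z = -1, Cauchy–Schwarz gives |f|² ≤ Tr{ρ² R⁻¹}, and D_2 ≤ D_max
does the rest. Extrema are attained because the commuting unitaries form a compact set. -/

theorem commute_logOnSupp {n : Type*} [Fintype n] [DecidableEq n] {A : Matrix n n ℂ}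
    (hA : A.IsHermitian) : Commute (logOnSupp A) A := by
  have h : Commute (logOnSupp A) (cfc (id : ℝ → ℝ) A) := cfc_commute_cfc _ _ A
  rwa [cfc_id ℝ A hA.isSelfAdjoint] at h

theorem cfc_exp_comp {n : Type*} [Fintype n] [DecidableEq n] {A : Matrix n n ℂ}
    (hA : A.IsHermitian) (g : ℝ → ℝ) :
    cfc Real.exp (cfc g A) = cfc (fun y => Real.exp (g y)) A :=
  (cfc_comp' Real.exp g A (by fun_prop) (A.finite_real_spectrum.continuousOn g) hA).symm

open scoped Matrix.Norms.L2Operator MatrixOrder Kronecker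
open Matrix

/-! ### Powers on the support and the entire family A^z. -/

section FunctionalCalculus

variable {n : Type*} [Fintype n] [DecidableEq n]

theorem continuousOn_spectrum (f : ℝ → ℝ) (A : Matrix n n ℂ) :
    ContinuousOn f (spectrum ℝ A) :=
  A.finite_real_spectrum.continuousOn f

theorem funOnSupp_isHermitian (f : ℝ → ℝ) (A : Matrix n n ℂ) : (funOnSupp f A).IsHermitian :=
  cfc_predicate _ A

theorem logOnSupp_isHermitian (A : Matrix n n ℂ) : (logOnSupp A).IsHermitian :=
  funOnSupp_isHermitian _ A

theorem powOnSupp_isHermitian (r : ℝ) (A : Matrix n n ℂ) : (powOnSupp r A).IsHermitian :=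
  funOnSupp_isHermitian _ A

theorem powOnSupp_conjTranspose (r : ℝ) (A : Matrix n n ℂ) :
    (powOnSupp r A)ᴴ = powOnSupp r A :=
  powOnSupp_isHermitian r A

theorem spectrum_nonneg {A : Matrix n n ℂ} (hA : A.PosSemidef) {x : ℝ} (hx : x ∈ spectrum ℝ A) :
    0 ≤ x :=
  spectrum_nonneg_of_nonneg (Matrix.nonneg_iff_posSemidef.mpr hA) hx

/-- Singular `A` and negative exponents are allowed because both sides vanish on the kernel. -/
theorem powOnSupp_mul_powOnSupp {A : Matrix n n ℂ} (hA : A.PosSemidef) (r s : ℝ) :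
    powOnSupp r A * powOnSupp s A = powOnSupp (r + s) A := by
  unfold powOnSupp funOnSupp
  rw [← cfc_mul _ _ A (continuousOn_spectrum _ A) (continuousOn_spectrum _ A)]
  refine cfc_congr fun x hx => ?_
  have h := spectrum_nonneg hA hx
  rcases h.eq_or_lt with h | h
  · simp [← h]
  · simp [h.ne', Real.rpow_add h]

theorem powOnSupp_one {A : Matrix n n ℂ} (hA : A.PosSemidef) : powOnSupp 1 A = A := by
  unfold powOnSupp funOnSupp
  conv_rhs => rw [← cfc_id ℝ A hA.isHermitian]
  refine cfc_congr fun x _ => ?_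
  by_cases h : x = 0 <;> simp [h]

theorem powOnSupp_posSemidef {A : Matrix n n ℂ} (hA : A.PosSemidef) (r : ℝ) :
    (powOnSupp r A).PosSemidef := by
  rw [← Matrix.nonneg_iff_posSemidef]
  refine cfc_nonneg fun x hx => ?_
  have h := spectrum_nonneg hA hx
  split_ifs
  · exact le_rfl
  · exact Real.rpow_nonneg h r

theorem powOnSupp_half_mul_self {A : Matrix n n ℂ} (hA : A.PosSemidef) :
    powOnSupp (1 / 2) A * powOnSupp (1 / 2) A = A := by
  rw [powOnSupp_mul_powOnSupp hA, add_halves, powOnSupp_one hA]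

theorem _root_.Matrix.PosSemidef.exists_eq_conjTranspose_mul_self {A : Matrix n n ℂ}
    (hA : A.PosSemidef) : ∃ M : Matrix n n ℂ, A = Mᴴ * M :=
  ⟨powOnSupp (1 / 2) A, by rw [powOnSupp_conjTranspose, powOnSupp_half_mul_self hA]⟩

theorem powOnSupp_zero_mul_powOnSupp {A : Matrix n n ℂ} (hA : A.PosSemidef) (r : ℝ) :
    powOnSupp 0 A * powOnSupp r A = powOnSupp r A := by
  rw [powOnSupp_mul_powOnSupp hA, zero_add]

theorem powOnSupp_mul_powOnSupp_zero {A : Matrix n n ℂ} (hA : A.PosSemidef) (r : ℝ) :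
    powOnSupp r A * powOnSupp 0 A = powOnSupp r A := by
  rw [powOnSupp_mul_powOnSupp hA, add_zero]

theorem powOnSupp_zero_mul_self {A : Matrix n n ℂ} (hA : A.PosSemidef) :
    powOnSupp 0 A * A = A := by
  simpa [powOnSupp_one hA] using powOnSupp_zero_mul_powOnSupp hA 1

theorem mul_powOnSupp_zero_self {A : Matrix n n ℂ} (hA : A.PosSemidef) :
    A * powOnSupp 0 A = A := by
  simpa [powOnSupp_one hA] using powOnSupp_mul_powOnSupp_zero hA 1

theorem powOnSupp_zero_of_posDef {A : Matrix n n ℂ} (hA : A.PosDef) : powOnSupp 0 A = 1 := by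
  have h := powOnSupp_zero_mul_self hA.posSemidef
  exact hA.isUnit.mul_right_cancel (by rw [h, one_mul])

theorem powOnSupp_neg_mul_powOnSupp {A : Matrix n n ℂ} (hA : A.PosDef) (r : ℝ) :
    powOnSupp (-r) A * powOnSupp r A = 1 := by
  rw [powOnSupp_mul_powOnSupp hA.posSemidef, neg_add_cancel, powOnSupp_zero_of_posDef hA]

theorem powOnSupp_mul_powOnSupp_neg {A : Matrix n n ℂ} (hA : A.PosDef) (r : ℝ) :
    powOnSupp r A * powOnSupp (-r) A = 1 := by
  rw [powOnSupp_mul_powOnSupp hA.posSemidef, add_neg_cancel, powOnSupp_zero_of_posDef hA]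

theorem powOnSupp_neg_one_of_posDef {A : Matrix n n ℂ} (hA : A.PosDef) :
    powOnSupp (-1) A = A⁻¹ := by
  refine (Matrix.inv_eq_left_inv ?_).symm
  simpa [powOnSupp_one hA.posSemidef] using powOnSupp_neg_mul_powOnSupp hA 1

/-- The entire family `z ↦ exp (z log A)`, with the logarithm evaluated on the support. -/
noncomputable def expLog (A : Matrix n n ℂ) (z : ℂ) : Matrix n n ℂ :=
  NormedSpace.exp (z • logOnSupp A)

theorem expLog_zero (A : Matrix n n ℂ) : expLog A 0 = 1 := by
  simp [expLog]

theorem expLog_add (A : Matrix n n ℂ) (z w : ℂ) :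
    expLog A (z + w) = expLog A z * expLog A w := by
  unfold expLog
  rw [add_smul, Matrix.exp_add_of_commute]
  exact ((Commute.refl _).smul_left z).smul_right w

theorem expLog_conjTranspose (A : Matrix n n ℂ) (z : ℂ) :
    (expLog A z)ᴴ = expLog A (star z) := by
  unfold expLog
  rw [← Matrix.exp_conjTranspose, Matrix.conjTranspose_smul, (logOnSupp_isHermitian A).eq]

theorem expLog_mem_unitaryGroup (A : Matrix n n ℂ) {z : ℂ} (hz : z.re = 0) :
    expLog A z ∈ Matrix.unitaryGroup n ℂ := by
  rw [Matrix.mem_unitaryGroup_iff, Matrix.star_eq_conjTranspose, expLog_conjTranspose,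
    ← expLog_add]
  have : z + star z = 0 := by
    apply Complex.ext <;> simp [hz]
  rw [this, expLog_zero]

theorem commute_expLog {A : Matrix n n ℂ} (hA : A.IsHermitian) (z : ℂ) :
    Commute (expLog A z) A :=
  ((commute_logOnSupp hA).smul_left z).exp_left

theorem expLog_mem_commutingUnitaries {A : Matrix n n ℂ} (hA : A.IsHermitian) {z : ℂ}
    (hz : z.re = 0) : expLog A z ∈ commutingUnitaries A :=
  ⟨expLog_mem_unitaryGroup A hz, commute_expLog hA z⟩

/-- With log set to 0 on the kernel, `expLog A x` is the identity there, whereas `powOnSupp x A` is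
0. The support projection accounts for exactly this difference. -/
theorem powOnSupp_zero_mul_expLog {A : Matrix n n ℂ} (hA : A.PosSemidef) (x : ℝ) :
    powOnSupp 0 A * expLog A x = powOnSupp x A := by
  have h : expLog A x = cfc (fun y : ℝ => Real.exp (x * Real.log y)) A := by
    have h1 : (x : ℂ) • logOnSupp A = cfc (fun y : ℝ => x * Real.log y) A := by
      rw [cfc_const_mul x _ A (continuousOn_spectrum _ A), Complex.coe_smul]
      congr 1
      refine cfc_congr fun y _ => ?_
      by_cases h : y = 0 <;> simp [h]
    unfold expLog
    rw [h1, ← CFC.real_exp_eq_normedSpace_exp (cfc_predicate _ A)]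
    exact cfc_exp_comp hA.isHermitian _
  rw [h]
  unfold powOnSupp funOnSupp
  rw [← cfc_mul _ _ A (continuousOn_spectrum _ A) (continuousOn_spectrum _ A)]
  refine cfc_congr fun y hy => ?_
  have h := spectrum_nonneg hA hy
  rcases h.eq_or_lt with h | h
  · simp [← h]
  · simp [h.ne', Real.rpow_def_of_pos h, mul_comm]

theorem powOnSupp_mul_expLog {A : Matrix n n ℂ} (hA : A.PosSemidef) (r x : ℝ) :
    powOnSupp r A * expLog A x = powOnSupp (r + x) A := by
  rw [← powOnSupp_mul_powOnSupp_zero hA, Matrix.mul_assoc, powOnSupp_zero_mul_expLog hA,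
    powOnSupp_mul_powOnSupp hA]

theorem hasDerivAt_expLog (A : Matrix n n ℂ) (z : ℂ) :
    HasDerivAt (expLog A) (expLog A z * logOnSupp A) z :=
  hasDerivAt_exp_smul_const (logOnSupp A) z

theorem commute_expLog_powOnSupp (A : Matrix n n ℂ) (z : ℂ) (r : ℝ) :
    Commute (expLog A z) (powOnSupp r A) := by
  have h : Commute (logOnSupp A) (powOnSupp r A) := cfc_commute_cfc _ _ A
  exact (h.smul_left z).exp_left

end FunctionalCalculus

/-! ### Trace and operator norm inequalities. -/

section Norms

variable {l m n : Type*} [Fintype l] [Fintype m] [Fintype n]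

/-- Cauchy–Schwarz for the Hilbert–Schmidt inner product; the source of the D_0 and D_2 bounds. -/
theorem norm_trace_mul_sq_le (A : Matrix m n ℂ) (B : Matrix n m ℂ) :
    ‖(A * B).trace‖ ^ 2 ≤ (A * Aᴴ).trace.re * (Bᴴ * B).trace.re := by
  let x : EuclideanSpace ℂ (m × n) := WithLp.toLp 2 fun p => star (A p.1 p.2)
  let y : EuclideanSpace ℂ (m × n) := WithLp.toLp 2 fun p => B p.2 p.1
  have h1 : (A * B).trace = inner ℂ x y := by
    simp [x, y, PiLp.inner_apply, Fintype.sum_prod_type, Matrix.trace, Matrix.mul_apply, mul_comm]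
  have h2 : (A * Aᴴ).trace.re = ‖x‖ ^ 2 := by
    simp [x, EuclideanSpace.norm_sq_eq, Fintype.sum_prod_type, Matrix.trace, Matrix.mul_apply,
      Complex.mul_conj, Complex.normSq_eq_norm_sq]
    norm_cast
  have h3 : (Bᴴ * B).trace.re = ‖y‖ ^ 2 := by
    simp [y, EuclideanSpace.norm_sq_eq, Fintype.sum_prod_type, Matrix.trace, Matrix.mul_apply,
      Complex.conj_mul']
    norm_cast
  rw [h1, h2, h3, ← mul_pow]
  gcongr
  exact norm_inner_le_norm x y

variable [DecidableEq l] [DecidableEq m] [DecidableEq n]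

/-- Writing S = M†M turns the trace into a sum of ⟨x, Cx⟩ over the conjugated rows x of M. -/
theorem norm_trace_mul_le {S : Matrix n n ℂ} (hS : S.PosSemidef) (C : Matrix n n ℂ) :
    ‖(S * C).trace‖ ≤ ‖C‖ * S.trace.re := by
  obtain ⟨M, rfl⟩ := hS.exists_eq_conjTranspose_mul_self
  let x : n → EuclideanSpace ℂ n := fun i => WithLp.toLp 2 fun j => star (M i j)
  have h1 : (Mᴴ * M * C).trace = ∑ i, inner ℂ (x i) (Matrix.toEuclideanCLM (𝕜 := ℂ) C (x i)) := by
    rw [Matrix.mul_assoc, Matrix.trace_mul_comm]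
    simp only [Matrix.trace, Matrix.diag]
    refine Finset.sum_congr rfl fun i _ => ?_
    simp [x, PiLp.inner_apply, Matrix.mul_apply, Matrix.mulVec, dotProduct, Finset.sum_mul,
      Finset.mul_sum, mul_assoc, mul_comm, mul_left_comm]
    rw [Finset.sum_comm]
  have h2 : (Mᴴ * M).trace.re = ∑ i, ‖x i‖ ^ 2 := by
    rw [Matrix.trace_mul_comm]
    simp [x, EuclideanSpace.norm_sq_eq, Matrix.trace, Matrix.mul_apply,
      Complex.mul_conj, Complex.normSq_eq_norm_sq]
    norm_cast
  rw [h1, h2, Finset.mul_sum]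
  refine norm_sum_le_of_le _ fun i _ => (norm_inner_le_norm _ _).trans ?_
  have := (Matrix.toEuclideanCLM (𝕜 := ℂ) C).le_opNorm (x i)
  rw [← Matrix.cstar_norm_def] at this
  nlinarith [norm_nonneg (x i)]

omit [DecidableEq m] in
theorem l2_norm_le_one_of_conjTranspose_mul_self {U : Matrix m n ℂ} (h : Uᴴ * U = 1) :
    ‖U‖ ≤ 1 := by
  have h1 := Matrix.l2_opNorm_conjTranspose_mul_self U
  rw [h] at h1
  -- Only an inequality, since the norm is 0 when the index type is empty.
  have h2 : ‖(1 : Matrix n n ℂ)‖ ≤ 1 := by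
    rw [← Matrix.diagonal_one, Matrix.l2_opNorm_diagonal]
    exact (pi_norm_le_iff_of_nonneg zero_le_one).2 fun i => by simp
  nlinarith [norm_nonneg U]

omit [DecidableEq l] in
theorem l2_norm_mul_le_one {A : Matrix l m ℂ} {B : Matrix m n ℂ} (hA : ‖A‖ ≤ 1) (hB : ‖B‖ ≤ 1) :
    ‖A * B‖ ≤ 1 :=
  (Matrix.l2_opNorm_mul A B).trans (mul_le_one₀ hA (norm_nonneg _) hB)

theorem l2_norm_le_one_of_unitary {U : Matrix n n ℂ} (h : U ∈ Matrix.unitaryGroup n ℂ) :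
    ‖U‖ ≤ 1 :=
  l2_norm_le_one_of_conjTranspose_mul_self (Matrix.mem_unitaryGroup_iff'.mp h)

theorem norm_powOnSupp_zero_le {A : Matrix n n ℂ} (hA : A.PosSemidef) : ‖powOnSupp 0 A‖ ≤ 1 := by
  have h := Matrix.l2_opNorm_conjTranspose_mul_self (powOnSupp 0 A)
  rw [powOnSupp_conjTranspose, powOnSupp_mul_powOnSupp hA, add_zero] at h
  nlinarith [norm_nonneg (powOnSupp 0 A)]

omit [DecidableEq m] in
theorem eq_mul_of_conjTranspose_mul_self_mul_eq {B : Matrix m n ℂ} {P : Matrix n n ℂ}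
    (h : Bᴴ * B * P = Bᴴ * B) : B * P = B := by
  have h1 : Bᴴ * (B * (P - 1)) = 0 := by
    rw [← Matrix.mul_assoc, Matrix.mul_sub, h, Matrix.mul_one, sub_self]
  have h2 : B * (P - 1) = 0 := by
    rw [← Matrix.conjTranspose_mul_self_eq_zero, Matrix.conjTranspose_mul, Matrix.mul_assoc, h1,
      Matrix.mul_zero]
  rwa [Matrix.mul_sub, Matrix.mul_one, sub_eq_zero] at h2

omit [DecidableEq m] in
/-- A weak form of the polar decomposition. -/
theorem exists_contraction_mul_sqrt (B : Matrix m n ℂ) :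
    ∃ K : Matrix m n ℂ, ‖K‖ ≤ 1 ∧ B = K * powOnSupp (1 / 2) (Bᴴ * B) := by
  have hR := Matrix.posSemidef_conjTranspose_mul_self B
  set R := Bᴴ * B with hRdef
  -- K = B|B|⁻¹ with the inverse taken on the support, so K†K is the support projection of B†B.
  refine ⟨B * powOnSupp (-(1 / 2)) R, ?_, ?_⟩
  · have h := Matrix.l2_opNorm_conjTranspose_mul_self (B * powOnSupp (-(1 / 2)) R)
    have h1 : (B * powOnSupp (-(1 / 2)) R)ᴴ * (B * powOnSupp (-(1 / 2)) R) = powOnSupp 0 R := by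
      rw [Matrix.conjTranspose_mul, powOnSupp_conjTranspose, Matrix.mul_assoc,
        ← Matrix.mul_assoc _ B, ← hRdef]
      nth_rw 2 [← powOnSupp_one hR]
      rw [powOnSupp_mul_powOnSupp hR, powOnSupp_mul_powOnSupp hR]
      norm_num
    rw [h1] at h
    nlinarith [norm_powOnSupp_zero_le hR, norm_nonneg (B * powOnSupp (-(1 / 2)) R)]
  · rw [Matrix.mul_assoc, powOnSupp_mul_powOnSupp hR, neg_add_cancel]
    exact (eq_mul_of_conjTranspose_mul_self_mul_eq (mul_powOnSupp_zero_self hR)).symm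

/-- The easy half of trace-norm duality: A = K|A|, and CK is again a contraction. -/
theorem norm_trace_mul_le_traceNorm (A C : Matrix n n ℂ) (hC : ‖C‖ ≤ 1) :
    ‖(A * C).trace‖ ≤ traceNorm A := by
  obtain ⟨K, hK, hA⟩ := exists_contraction_mul_sqrt A
  have hS := powOnSupp_posSemidef (Matrix.posSemidef_conjTranspose_mul_self A) (1 / 2)
  have h1 : (A * C).trace = (powOnSupp (1 / 2) (Aᴴ * A) * (C * K)).trace := by
    conv_lhs => rw [hA]
    rw [Matrix.mul_assoc, Matrix.trace_mul_comm, Matrix.mul_assoc]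
  rw [h1]
  refine (norm_trace_mul_le hS _).trans ?_
  exact mul_le_of_le_one_left (Complex.nonneg_iff.mp hS.trace_nonneg).1 (l2_norm_mul_le_one hC hK)

end Norms

/-! ### The embedding Y ↦ Y ⊗ 1. -/

section Ampliation

variable {b : Type*} [Fintype b] [DecidableEq b]

/-- The embedding `Y ↦ Y ⊗ 1`. -/
def ampliation (e : Type*) [Fintype e] [DecidableEq e] :
    Matrix b b ℂ →⋆ₐ[ℂ] Matrix (b × e) (b × e) ℂ where
  toFun Y := Y ⊗ₖ (1 : Matrix e e ℂ)
  map_one' := Matrix.one_kronecker_one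
  map_mul' X Y := by rw [← Matrix.mul_kronecker_mul, Matrix.one_mul]
  map_zero' := Matrix.zero_kronecker _
  map_add' X Y := Matrix.add_kronecker _ _ _
  commutes' r := by
    simp [Algebra.algebraMap_eq_smul_one, Matrix.smul_kronecker]
  map_star' X := by
    simp [Matrix.star_eq_conjTranspose, Matrix.conjTranspose_kronecker]

variable {e : Type*} [Fintype e] [DecidableEq e]

theorem ampliation_apply (Y : Matrix b b ℂ) (i j : b) (k l : e) :
    ampliation e Y (i, k) (j, l) = Y i j * (1 : Matrix e e ℂ) k l := rfl

theorem ampliation_conjTranspose (Y : Matrix b b ℂ) :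
    (ampliation e Y)ᴴ = ampliation e Yᴴ :=
  (map_star (ampliation e) Y).symm

theorem norm_ampliation_le (Y : Matrix b b ℂ) : ‖ampliation e Y‖ ≤ ‖Y‖ :=
  NonUnitalStarAlgHom.norm_apply_le (ampliation e) Y

end Ampliation

/-! ### The dilated channel, its adjoint and the recovery map. -/

section Dilation

variable {h b e : Type*} [Fintype h] [Fintype b] [Fintype e] [DecidableEq h] [DecidableEq b]
  [DecidableEq e] (U : Matrix (b × e) h ℂ)

omit [DecidableEq h] in
theorem trace_dilationMap_mul (θ : Matrix h h ℂ) (Y : Matrix b b ℂ) :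
    (dilationMap U θ * Y).trace = (θ * (Uᴴ * ampliation e Y * U)).trace := by
  have h1 : (θ * (Uᴴ * ampliation e Y * U)).trace = (U * θ * Uᴴ * ampliation e Y).trace := by
    rw [← Matrix.mul_assoc, Matrix.trace_mul_comm]
    simp only [Matrix.mul_assoc]
  rw [h1]
  generalize hM : U * θ * Uᴴ = M
  have h2 : dilationMap U θ = Matrix.of fun i j => ∑ k, M (i, k) (j, k) := by
    rw [← hM]; rfl
  rw [h2]
  simp only [Matrix.trace, Matrix.diag, Matrix.mul_apply, Matrix.of_apply, Fintype.sum_prod_type,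
    ampliation_apply, Matrix.one_apply, mul_ite, mul_one, mul_zero, Finset.sum_ite_eq',
    Finset.mem_univ, if_true, Finset.sum_mul]
  exact Finset.sum_congr rfl fun i _ => Finset.sum_comm

omit [Fintype b] [DecidableEq h] [DecidableEq b] [DecidableEq e] in
theorem dilationMap_eq_sum (θ : Matrix h h ℂ) :
    dilationMap U θ = ∑ k : e, (Matrix.of fun i j => U (i, k) j) * θ *
      (Matrix.of fun i j => U (i, k) j : Matrix b h ℂ)ᴴ := by
  ext i j
  simp [dilationMap, Matrix.sum_apply, Matrix.mul_apply]

omit [DecidableEq h] [DecidableEq b] [DecidableEq e] in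
theorem dilationMap_posSemidef {θ : Matrix h h ℂ} (hθ : θ.PosSemidef) :
    (dilationMap U θ).PosSemidef := by
  rw [dilationMap_eq_sum]
  exact Matrix.posSemidef_sum _ fun k _ => hθ.mul_mul_conjTranspose_same _

omit [Fintype b] [DecidableEq h] [DecidableEq b] [DecidableEq e] in
theorem dilationMap_conjTranspose (θ : Matrix h h ℂ) :
    (dilationMap U θ)ᴴ = dilationMap U θᴴ := by
  simp [dilationMap_eq_sum, Matrix.conjTranspose_sum, Matrix.mul_assoc]

theorem adjointMap_dilationMap (Y : Matrix b b ℂ) :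
    adjointMap (dilationMap U) Y = Uᴴ * ampliation e Y * U := by
  refine Matrix.ext_iff_trace_mul_left.mpr fun X => ?_
  have h1 := trace_adjointMap (dilationMap U) Xᴴ Y
  rwa [dilationMap_conjTranspose, Matrix.conjTranspose_conjTranspose, trace_dilationMap_mul] at h1

/-- The range of U√θ lies in supp N(θ) ⊗ H_E: for Q the projection off supp N(θ), the squared
Hilbert–Schmidt norm of (Q ⊗ 1)U√θ equals Tr{N(θ)Q} = 0. -/
theorem ampliation_supp_mul (θ : Matrix h h ℂ) (hθ : θ.PosSemidef) :
    ampliation e (powOnSupp 0 (dilationMap U θ)) * U * powOnSupp (1 / 2) θ =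
      U * powOnSupp (1 / 2) θ := by
  have hN := dilationMap_posSemidef U hθ
  set Q : Matrix b b ℂ := 1 - powOnSupp 0 (dilationMap U θ) with hQ
  have hQN : dilationMap U θ * Q = 0 := by
    rw [hQ, Matrix.mul_sub, mul_powOnSupp_zero_self hN, Matrix.mul_one, sub_self]
  have h0 : ampliation e Q * U * powOnSupp (1 / 2) θ = 0 := by
    rw [← Matrix.trace_conjTranspose_mul_self_eq_zero_iff]
    have h1 : (θ * (Uᴴ * ampliation e (Q * Qᴴ)ᴴ * U)).trace = 0 := by
      rw [← trace_dilationMap_mul, Matrix.conjTranspose_mul, Matrix.conjTranspose_conjTranspose,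
        ← Matrix.mul_assoc, hQN, Matrix.zero_mul, Matrix.trace_zero]
    have hQh : Qᴴ = Q := by
      rw [hQ, Matrix.conjTranspose_sub, Matrix.conjTranspose_one, powOnSupp_conjTranspose]
    rw [← h1, Matrix.conjTranspose_mul, powOnSupp_conjTranspose, Matrix.mul_assoc,
      ← Matrix.mul_assoc _ _ (powOnSupp (1 / 2) θ), Matrix.trace_mul_comm, Matrix.mul_assoc,
      powOnSupp_half_mul_self hθ, Matrix.trace_mul_comm, Matrix.conjTranspose_mul,
      ampliation_conjTranspose, Matrix.conjTranspose_mul, Matrix.conjTranspose_conjTranspose, hQh,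
      map_mul]
    simp only [Matrix.mul_assoc]
  have h2 : ampliation e Q = 1 - ampliation e (powOnSupp 0 (dilationMap U θ)) := by
    rw [hQ, map_sub, map_one]
  rw [h2, Matrix.sub_mul, Matrix.sub_mul, Matrix.one_mul, sub_eq_zero] at h0
  exact h0.symm

/-- A square root `B` of the swiveled Petz recovery map: `R(N(ρ)) = B† B`. -/
noncomputable def swivelRoot (ρ σ : Matrix h h ℂ) (V : Matrix b b ℂ) (W : Matrix h h ℂ) :
    Matrix (b × e) h ℂ :=
  ampliation e (powOnSupp (1 / 2) (dilationMap U ρ) * Vᴴ * powOnSupp (-1 / 2) (dilationMap U σ)) *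
    U * powOnSupp (1 / 2) σ * Wᴴ

theorem swiveledPetzMap_eq {ρ : Matrix h h ℂ} (hρ : ρ.PosSemidef) (σ : Matrix h h ℂ)
    (V : Matrix b b ℂ) (W : Matrix h h ℂ) :
    swiveledPetzMap σ (dilationMap U) V W (dilationMap U ρ) =
      (swivelRoot U ρ σ V W)ᴴ * swivelRoot U ρ σ V W := by
  have hN := dilationMap_posSemidef U hρ
  unfold swiveledPetzMap petzMap swivelRoot
  rw [adjointMap_dilationMap]
  -- The innermost N(ρ) is split into two square roots, one for each of B† and B.
  conv_lhs => enter [1, 2, 1, 2, 1, 2, 2, 1, 2, 1, 2]; rw [← powOnSupp_half_mul_self hN]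
  simp only [Matrix.conjTranspose_mul, Matrix.conjTranspose_conjTranspose,
    ampliation_conjTranspose, powOnSupp_conjTranspose, map_mul, Matrix.mul_assoc]

end Dilation

/-! ### Bounds for A^z on vertical strips. -/

section ExpLogNorm

variable {n : Type*} [Fintype n] [DecidableEq n]

theorem norm_expLog_le_one (A : Matrix n n ℂ) {z : ℂ} (hz : z.re = 0) : ‖expLog A z‖ ≤ 1 :=
  l2_norm_le_one_of_unitary (expLog_mem_unitaryGroup A hz)

theorem continuous_expLog (A : Matrix n n ℂ) : Continuous (expLog A) :=
  continuous_iff_continuousAt.mpr fun z => (hasDerivAt_expLog A z).continuousAt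

/-- The imaginary part of z contributes a unitary factor, so it suffices to bound A^x for x in a
compact interval. -/
theorem exists_norm_expLog_le (A : Matrix n n ℂ) (r : ℝ) :
    ∃ C : ℝ, 0 ≤ C ∧ ∀ z : ℂ, |z.re| ≤ r → ‖expLog A z‖ ≤ C := by
  obtain ⟨C, hC⟩ := (isCompact_Icc (a := -r) (b := r)).exists_bound_of_continuousOn
    (f := fun x : ℝ => expLog A x)
    ((continuous_expLog A).comp Complex.continuous_ofReal).continuousOn
  refine ⟨max C 0, le_max_right _ _, fun z hz => le_max_of_le_left ?_⟩
  have h1 : expLog A z = expLog A (z.re : ℂ) * expLog A (z.im * Complex.I) := by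
    rw [← expLog_add, Complex.re_add_im]
  rw [h1]
  refine (norm_mul_le _ _).trans ?_
  have h2 := norm_expLog_le_one A (z := z.im * Complex.I) (by simp)
  have h3 := hC z.re (abs_le.mp hz)
  nlinarith [norm_nonneg (expLog A (z.re : ℂ))]

end ExpLogNorm

/-! ### Differentiated three lines theorem. -/

section ThreeLines

open Complex.HadamardThreeLines in
/-- If `f` is bounded by `1` on the imaginary axis and by `b` on the line `re z = 1`, and
`f 0 = 1`, then `exp (re (f' 0)) ≤ b`. -/
theorem exp_deriv_le_of_three_lines {f : ℂ → ℂ} {d : ℂ} {b C : ℝ} (hf : Differentiable ℂ f)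
    (hbdd : ∀ z : ℂ, 0 ≤ z.re → z.re ≤ 1 → ‖f z‖ ≤ C) (h0 : ∀ z : ℂ, z.re = 0 → ‖f z‖ ≤ 1)
    (h1 : ∀ z : ℂ, z.re = 1 → ‖f z‖ ≤ b) (hf0 : f 0 = 1) (hd : HasDerivAt f d 0) :
    Real.exp d.re ≤ b := by
  have hb0 : 0 ≤ b := (norm_nonneg _).trans (h1 1 rfl)
  -- Replacing b by b + ε makes its logarithm meaningful even before b > 0 is known.
  refine le_of_forall_pos_le_add fun ε hε => ?_
  have hc : 0 < b + ε := by linarith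
  have key : ∀ x : ℝ, 0 ≤ x → x ≤ 1 → (f x).re ≤ Real.exp (Real.log (b + ε) * x) := by
    intro x hx0 hx1
    have h := norm_le_interp_of_mem_verticalClosedStrip' (f := f) (z := x) (a := 1) (b := b + ε)
      (l := 0) (u := 1) zero_lt_one (by simp [verticalClosedStrip, hx0, hx1])
      hf.diffContOnCl
      ⟨C, by rintro _ ⟨z, hz, rfl⟩; exact hbdd z hz.1 hz.2⟩
      (fun z hz => h0 z hz) (fun z hz => (h1 z hz).trans (by linarith))
    simp only [Complex.ofReal_re, sub_zero, div_one, Real.one_rpow, one_mul] at h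
    rw [Real.rpow_def_of_pos hc] at h
    exact (Complex.re_le_norm _).trans h
  have hd1 : HasDerivAt (fun x : ℝ => (f x).re) d.re 0 := by
    have : HasDerivAt f d ((0 : ℝ) : ℂ) := by simpa using hd
    exact this.real_of_complex
  have hd2 : HasDerivAt (fun x : ℝ => Real.exp (Real.log (b + ε) * x)) (Real.log (b + ε)) 0 := by
    simpa using ((hasDerivAt_id (0 : ℝ)).const_mul (Real.log (b + ε))).exp
  -- Both functions equal 1 at 0 and one dominates the other on [0, 1], so their right derivatives
  -- at 0 are ordered alike.
  have hle : d.re ≤ Real.log (b + ε) := by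
    have h := hd2.sub hd1
    rw [← sub_nonneg]
    refine ge_of_tendsto h.tendsto_slope_zero_right ?_
    filter_upwards [Ioo_mem_nhdsGT (zero_lt_one' ℝ)] with x hx
    have := key x hx.1.le hx.2.le
    have hx0 := hx.1
    simp only [zero_add, Pi.sub_apply, mul_zero, Real.exp_zero, Complex.ofReal_zero, hf0,
      Complex.one_re, sub_self, sub_zero, smul_eq_mul]
    exact mul_nonneg (inv_nonneg.mpr hx0.le) (sub_nonneg.mpr this)
  calc Real.exp d.re ≤ Real.exp (Real.log (b + ε)) := Real.exp_le_exp.mpr hle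
    _ = b + ε := Real.exp_log hc

end ThreeLines

/-! ### The interpolating function: derivative at 0, interior bounds. -/

section SwivelFunction

variable {h b e : Type*} [Fintype h] [Fintype b] [Fintype e] [DecidableEq h] [DecidableEq b]
  [DecidableEq e] (U : Matrix (b × e) h ℂ)

/-- The map `Y ↦ U† (Y ⊗ 1) U`. -/
def dilationAdjoint : Matrix b b ℂ →ₗ[ℂ] Matrix h h ℂ where
  toFun Y := Uᴴ * ampliation e Y * U
  map_add' X Y := by rw [map_add, Matrix.mul_add, Matrix.add_mul]
  map_smul' c Y := by rw [map_smul, Matrix.mul_smul, Matrix.smul_mul, RingHom.id_apply]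

/-- The function `Tr{ρ ρ^{-z/2} U† (N(ρ)^{z/2} N(σ)^{-z/2} ⊗ 1) U σ^{z/2}}`. -/
noncomputable def swivelFun (ρ σ : Matrix h h ℂ) (z : ℂ) : ℂ :=
  (ρ * (expLog ρ (-(1 / 2) * z) * dilationAdjoint U (expLog (dilationMap U ρ) (1 / 2 * z) *
    expLog (dilationMap U σ) (-(1 / 2) * z)) * expLog σ (1 / 2 * z))).trace

variable {U} in
theorem swivelFun_zero (hU : Uᴴ * U = 1) (ρ σ : Matrix h h ℂ) :
    swivelFun U ρ σ 0 = ρ.trace := by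
  simp [swivelFun, expLog_zero, dilationAdjoint, hU]

theorem hasDerivAt_expLog_mul (A : Matrix h h ℂ) (c z : ℂ) :
    HasDerivAt (fun z => expLog A (c * z)) (c • (expLog A (c * z) * logOnSupp A)) z := by
  have h1 : HasDerivAt (fun z : ℂ => c * z) c z := by
    simpa using (hasDerivAt_id z).const_mul c
  exact HasDerivAt.scomp z (hasDerivAt_expLog A (c * z)) h1

theorem hasDerivAt_swivelFun (ρ σ : Matrix h h ℂ) (z : ℂ) :
    HasDerivAt (swivelFun U ρ σ)
      (ρ * (((-(1 / 2 : ℂ)) • (expLog ρ (-(1 / 2) * z) * logOnSupp ρ) *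
          dilationAdjoint U (expLog (dilationMap U ρ) (1 / 2 * z) *
            expLog (dilationMap U σ) (-(1 / 2) * z)) +
        expLog ρ (-(1 / 2) * z) * dilationAdjoint U
          ((1 / 2 : ℂ) • (expLog (dilationMap U ρ) (1 / 2 * z) * logOnSupp (dilationMap U ρ)) *
            expLog (dilationMap U σ) (-(1 / 2) * z) +
          expLog (dilationMap U ρ) (1 / 2 * z) * (-(1 / 2 : ℂ)) •
            (expLog (dilationMap U σ) (-(1 / 2) * z) * logOnSupp (dilationMap U σ)))) *
          expLog σ (1 / 2 * z) +
        expLog ρ (-(1 / 2) * z) * dilationAdjoint U (expLog (dilationMap U ρ) (1 / 2 * z) *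
            expLog (dilationMap U σ) (-(1 / 2) * z)) *
          ((1 / 2 : ℂ) • (expLog σ (1 / 2 * z) * logOnSupp σ)))).trace z := by
  have h1 := (hasDerivAt_expLog_mul (dilationMap U ρ) (1 / 2) z).mul
    (hasDerivAt_expLog_mul (dilationMap U σ) (-(1 / 2)) z)
  have h2 := (LinearMap.toContinuousLinearMap (dilationAdjoint U)).hasFDerivAt.comp_hasDerivAt z h1
  have h3 := (((hasDerivAt_expLog_mul ρ (-(1 / 2)) z).mul h2).mul
    (hasDerivAt_expLog_mul σ (1 / 2) z)).const_mul ρ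
  exact (LinearMap.toContinuousLinearMap
    (Matrix.traceLinearMap h ℂ ℂ)).hasFDerivAt.comp_hasDerivAt z h3

theorem differentiable_swivelFun (ρ σ : Matrix h h ℂ) : Differentiable ℂ (swivelFun U ρ σ) :=
  fun z => (hasDerivAt_swivelFun U ρ σ z).differentiableAt

-- At 0 every exponential is 1, so the product rule leaves four logarithms weighted by ±1/2; duality
-- of the partial trace moves the two output logarithms onto N(ρ).
variable {U} in
theorem hasDerivAt_swivelFun_zero (hU : Uᴴ * U = 1) (ρ σ : Matrix h h ℂ) :
    HasDerivAt (swivelFun U ρ σ)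
      (-(1 / 2) * ((ρ * (logOnSupp ρ - logOnSupp σ)).trace -
        (dilationMap U ρ * (logOnSupp (dilationMap U ρ) -
          logOnSupp (dilationMap U σ))).trace)) 0 := by
  convert hasDerivAt_swivelFun U ρ σ 0 using 1
  have h1 : dilationAdjoint U 1 = 1 := by simp [dilationAdjoint, hU]
  have h2 : ∀ Y, (dilationMap U ρ * Y).trace = (ρ * dilationAdjoint U Y).trace :=
    trace_dilationMap_mul U ρ
  simp only [mul_zero, expLog_zero, h1, mul_one, one_mul, h2, map_add, map_smul,
    Matrix.mul_add, Matrix.mul_sub, Matrix.trace_add, Matrix.trace_sub, Matrix.mul_smul,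
    Matrix.trace_smul, smul_eq_mul]
  ring

theorem norm_trace_mul_mul_le {ρ : Matrix h h ℂ} (hρ : ρ.PosSemidef) (A B : Matrix h h ℂ)
    (Y : Matrix b b ℂ) {U : Matrix (b × e) h ℂ} (hU : Uᴴ * U = 1) :
    ‖(ρ * (A * dilationAdjoint U Y * B)).trace‖ ≤ ‖A‖ * ‖Y‖ * ‖B‖ * ρ.trace.re := by
  have ht : 0 ≤ ρ.trace.re := (Complex.nonneg_iff.mp hρ.trace_nonneg).1
  have hU1 := l2_norm_le_one_of_conjTranspose_mul_self hU
  have hU2 : ‖Uᴴ‖ ≤ 1 := by rwa [Matrix.l2_opNorm_conjTranspose]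
  have h1 : ‖dilationAdjoint U Y‖ ≤ ‖Y‖ := by
    calc ‖Uᴴ * ampliation e Y * U‖ ≤ ‖Uᴴ‖ * ‖ampliation e Y‖ * ‖U‖ :=
          (Matrix.l2_opNorm_mul _ _).trans
            (mul_le_mul_of_nonneg_right (Matrix.l2_opNorm_mul _ _) (norm_nonneg _))
      _ ≤ 1 * ‖Y‖ * 1 := by
          gcongr
          exact norm_ampliation_le Y
      _ = ‖Y‖ := by ring
  refine (norm_trace_mul_le hρ _).trans ?_
  gcongr
  refine (norm_mul_le _ _).trans ?_
  gcongr
  refine (norm_mul_le _ _).trans ?_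
  gcongr

variable {U} in
theorem norm_swivelFun_le_one (hU : Uᴴ * U = 1) {ρ : Matrix h h ℂ} (hρ : IsDensity ρ)
    (σ : Matrix h h ℂ) {z : ℂ} (hz : z.re = 0) : ‖swivelFun U ρ σ z‖ ≤ 1 := by
  refine (norm_trace_mul_mul_le hρ.1 _ _ _ hU).trans ?_
  rw [hρ.2, Complex.one_re, mul_one]
  have hz1 : (1 / 2 * z).re = 0 := by simp [Complex.mul_re, hz]
  have hz2 : (-(1 / 2) * z).re = 0 := by simp [Complex.mul_re, hz]
  refine mul_le_one₀ (mul_le_one₀ (norm_expLog_le_one _ hz2) (norm_nonneg _)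
    (l2_norm_mul_le_one ?_ ?_)) (norm_nonneg _) (norm_expLog_le_one _ hz1)
  exacts [norm_expLog_le_one _ hz1, norm_expLog_le_one _ hz2]

variable {U} in
theorem exists_norm_swivelFun_le (hU : Uᴴ * U = 1) {ρ : Matrix h h ℂ} (hρ : ρ.PosSemidef)
    (σ : Matrix h h ℂ) : ∃ C : ℝ, ∀ z : ℂ, |z.re| ≤ 1 → ‖swivelFun U ρ σ z‖ ≤ C := by
  obtain ⟨C1, h1, hC1⟩ := exists_norm_expLog_le ρ 1
  obtain ⟨C2, h2, hC2⟩ := exists_norm_expLog_le (dilationMap U ρ) 1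
  obtain ⟨C3, h3, hC3⟩ := exists_norm_expLog_le (dilationMap U σ) 1
  obtain ⟨C4, h4, hC4⟩ := exists_norm_expLog_le σ 1
  refine ⟨C1 * (C2 * C3) * C4 * ρ.trace.re, fun z hz => ?_⟩
  have hz1 : |(1 / 2 * z).re| ≤ 1 := by
    simp only [Complex.mul_re, Complex.div_ofNat_re, Complex.one_re, Complex.div_ofNat_im,
      Complex.one_im, zero_div, zero_mul, sub_zero, abs_mul]
    rw [abs_of_pos (by norm_num : (0 : ℝ) < 1 / 2)]
    linarith [abs_nonneg z.re]
  have hz2 : |(-(1 / 2) * z).re| ≤ 1 := by rwa [neg_mul, Complex.neg_re, abs_neg]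
  refine (norm_trace_mul_mul_le hρ _ _ _ hU).trans ?_
  have ht : 0 ≤ ρ.trace.re := (Complex.nonneg_iff.mp hρ.trace_nonneg).1
  gcongr
  · exact hC1 _ hz2
  · refine (norm_mul_le _ _).trans ?_
    gcongr
    exacts [hC2 _ hz1, hC3 _ hz2]
  · exact hC4 _ hz1

end SwivelFunction

/-! ### Bounds on the lines Re z = 1 and Re z = -1. -/

section EdgeBounds

theorem powOnSupp_mul_expLog_add {n : Type*} [Fintype n] [DecidableEq n] {A : Matrix n n ℂ}
    (hA : A.PosSemidef) (r x : ℝ) (u : ℂ) :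
    powOnSupp r A * expLog A (x + u) = powOnSupp (r + x) A * expLog A u := by
  rw [expLog_add, ← Matrix.mul_assoc, powOnSupp_mul_expLog hA]

theorem powOnSupp_zero_mul_expLog_add {n : Type*} [Fintype n] [DecidableEq n] {A : Matrix n n ℂ}
    (hA : A.PosSemidef) (x : ℝ) (u : ℂ) :
    powOnSupp 0 A * expLog A (x + u) = expLog A u * powOnSupp x A := by
  rw [powOnSupp_mul_expLog_add hA, zero_add, (commute_expLog_powOnSupp A u x).eq]

theorem expLog_add_mul_powOnSupp_zero {n : Type*} [Fintype n] [DecidableEq n] {A : Matrix n n ℂ}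
    (hA : A.PosSemidef) (x : ℝ) (u : ℂ) :
    expLog A (x + u) * powOnSupp 0 A = expLog A u * powOnSupp x A := by
  rw [(commute_expLog_powOnSupp A _ 0).eq, powOnSupp_zero_mul_expLog_add hA]

variable {h b e : Type*} [Fintype h] [Fintype b] [Fintype e] [DecidableEq h] [DecidableEq b]
  [DecidableEq e] {U : Matrix (b × e) h ℂ}

variable (U) in
/-- The partial isometry that swivels the factors on the lines `re z = ±1`. -/
noncomputable def swivelPhase (ρ : Matrix h h ℂ) (u : ℂ) : Matrix h (b × e) ℂ :=
  expLog ρ (-u) * Uᴴ * ampliation e (expLog (dilationMap U ρ) u)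

theorem expLog_mul_conjTranspose {n : Type*} [Fintype n] [DecidableEq n] (A : Matrix n n ℂ)
    {u : ℂ} (hu : u.re = 0) : expLog A u * (expLog A u)ᴴ = 1 :=
  Matrix.mem_unitaryGroup_iff.mp (expLog_mem_unitaryGroup A hu)

theorem expLog_conjTranspose_of_re_eq_zero {n : Type*} [Fintype n] [DecidableEq n]
    (A : Matrix n n ℂ) {u : ℂ} (hu : u.re = 0) : (expLog A u)ᴴ = expLog A (-u) := by
  rw [expLog_conjTranspose]
  congr 1
  apply Complex.ext <;> simp [hu]

theorem swivelPhase_mul_conjTranspose (hU : Uᴴ * U = 1) (ρ : Matrix h h ℂ) {u : ℂ}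
    (hu : u.re = 0) : swivelPhase U ρ u * (swivelPhase U ρ u)ᴴ = 1 := by
  unfold swivelPhase
  have h1 := expLog_mul_conjTranspose ρ (u := -u) (by simp [hu])
  have h2 := expLog_mul_conjTranspose (dilationMap U ρ) hu
  calc _ = expLog ρ (-u) * (Uᴴ * ampliation e (expLog (dilationMap U ρ) u *
        (expLog (dilationMap U ρ) u)ᴴ) * U) * (expLog ρ (-u))ᴴ := by
        simp only [Matrix.conjTranspose_mul, Matrix.conjTranspose_conjTranspose,
          ampliation_conjTranspose, map_mul, Matrix.mul_assoc]
    _ = 1 := by rw [h2, map_one, Matrix.mul_one, hU, Matrix.mul_one, h1]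

theorem norm_swivelPhase_le (hU : Uᴴ * U = 1) (ρ : Matrix h h ℂ) {u : ℂ}
    (hu : u.re = 0) : ‖swivelPhase U ρ u‖ ≤ 1 := by
  rw [← Matrix.l2_opNorm_conjTranspose]
  apply l2_norm_le_one_of_conjTranspose_mul_self
  rw [Matrix.conjTranspose_conjTranspose, swivelPhase_mul_conjTranspose hU ρ hu]

/-- Each exponent ±z/2 splits into ±1/2 and ±u. The phases of σ and N(σ) become the swivels, those
of ρ and N(ρ) go into `swivelPhase`. The support lemmas supply the projections that turn `expLog`
into powers on the support. -/
theorem swivelFun_one_add {ρ σ : Matrix h h ℂ} (hρ : ρ.PosSemidef) (hσ : σ.PosSemidef)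
    (hsupp : powOnSupp 0 σ * ρ = ρ) {u : ℂ} (hu : u.re = 0) :
    swivelFun U ρ σ (1 + 2 * u) = (powOnSupp (1 / 2) ρ * (swivelPhase U ρ u *
      swivelRoot U ρ σ (expLog (dilationMap U σ) u) (expLog σ (-u)))).trace := by
  have hNρ := dilationMap_posSemidef U hρ
  have hNσ := dilationMap_posSemidef U hσ
  have e1 : (1 / 2 : ℂ) * (1 + 2 * u) = ((1 / 2 : ℝ) : ℂ) + u := by push_cast; ring
  have e2 : (-(1 / 2) : ℂ) * (1 + 2 * u) = ((-(1 / 2) : ℝ) : ℂ) + -u := by push_cast; ring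
  set S := powOnSupp (1 / 2) ρ with hS
  have hρS : ρ * expLog ρ ((-(1 / 2) : ℝ) + -u) = S * expLog ρ (-u) := by
    conv_lhs => enter [1]; rw [← powOnSupp_one hρ]
    rw [powOnSupp_mul_expLog_add hρ]
    norm_num [hS]
  have hσS : powOnSupp 0 σ * S = S := by
    have : S = ρ * powOnSupp (-(1 / 2)) ρ := by
      conv_rhs => enter [1]; rw [← powOnSupp_one hρ]
      rw [powOnSupp_mul_powOnSupp hρ]
      norm_num [hS]
    rw [this, ← Matrix.mul_assoc, hsupp]
  have hS1 : expLog σ ((1 / 2 : ℝ) + u) * S = powOnSupp (1 / 2) σ * expLog σ u * S := by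
    conv_lhs => rw [← hσS]
    rw [← Matrix.mul_assoc, expLog_add_mul_powOnSupp_zero hσ, (commute_expLog_powOnSupp σ u _).eq]
  have hS2 : ampliation e (expLog (dilationMap U σ) ((-(1 / 2) : ℝ) + -u)) *
      (U * powOnSupp (1 / 2) σ) =
      ampliation e (expLog (dilationMap U σ) (-u) * powOnSupp (-(1 / 2)) (dilationMap U σ)) *
        (U * powOnSupp (1 / 2) σ) := by
    have h1 := ampliation_supp_mul U σ hσ
    rw [Matrix.mul_assoc] at h1
    conv_lhs => rw [← h1]
    rw [← Matrix.mul_assoc, ← map_mul, expLog_add_mul_powOnSupp_zero hNσ]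
  have hS3 : S * expLog ρ (-u) * (Uᴴ * ampliation e (expLog (dilationMap U ρ) ((1 / 2 : ℝ) + u))) =
      S * expLog ρ (-u) * (Uᴴ * ampliation e (expLog (dilationMap U ρ) u *
        powOnSupp (1 / 2) (dilationMap U ρ))) := by
    have h1 := congrArg Matrix.conjTranspose (ampliation_supp_mul U ρ hρ)
    simp only [Matrix.conjTranspose_mul, powOnSupp_conjTranspose, ampliation_conjTranspose] at h1
    rw [← (commute_expLog_powOnSupp ρ (-u) (1 / 2)).eq, Matrix.mul_assoc, Matrix.mul_assoc,
      ← Matrix.mul_assoc _ Uᴴ, ← Matrix.mul_assoc _ Uᴴ, ← h1]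
    simp only [Matrix.mul_assoc]
    rw [← map_mul, ← map_mul, powOnSupp_zero_mul_expLog_add hNρ, ← Matrix.mul_assoc (powOnSupp 0 _),
      ← (commute_expLog_powOnSupp _ u 0).eq, Matrix.mul_assoc (expLog _ u),
      powOnSupp_zero_mul_powOnSupp hNρ]
  unfold swivelFun dilationAdjoint swivelRoot swivelPhase
  rw [e1, e2, ← Matrix.mul_assoc, ← Matrix.mul_assoc, hρS]
  simp only [LinearMap.coe_mk, AddHom.coe_mk]
  rw [expLog_conjTranspose_of_re_eq_zero _ hu,
    expLog_conjTranspose_of_re_eq_zero _ (u := -u) (by simp [hu]), neg_neg, map_mul]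
  -- Cyclicity places √ρ next to the σ factor, where supp ρ ⊆ supp σ can be used; it is cycled back
  -- afterwards.
  calc _ = (expLog ρ (-u) * (Uᴴ * (ampliation e (expLog (dilationMap U ρ) ((1 / 2 : ℝ) + u)) *
        ampliation e (expLog (dilationMap U σ) ((-(1 / 2) : ℝ) + -u))) * U) *
        (expLog σ ((1 / 2 : ℝ) + u) * S)).trace := by
        rw [Matrix.mul_assoc S, Matrix.mul_assoc S, Matrix.trace_mul_comm]
        simp only [Matrix.mul_assoc]
    _ = (S * expLog ρ (-u) * (Uᴴ * ampliation e (expLog (dilationMap U ρ) ((1 / 2 : ℝ) + u))) *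
        (ampliation e (expLog (dilationMap U σ) ((-(1 / 2) : ℝ) + -u)) *
        (U * powOnSupp (1 / 2) σ)) * expLog σ u).trace := by
        rw [hS1]
        simp only [Matrix.mul_assoc]
        rw [Matrix.trace_mul_comm S]
        simp only [Matrix.mul_assoc]
    _ = _ := by
        rw [hS2, hS3]
        simp only [Matrix.mul_assoc, map_mul, neg_div]

/-- With B = K√R, the trace is Tr{√ρ · (phase · K) · √R}, and phase · K is a contraction, so
trace-norm duality applies to √ρ√R. -/
theorem norm_swivelFun_sq_le_fidelity (hU : Uᴴ * U = 1) {ρ σ : Matrix h h ℂ} (hρ : ρ.PosSemidef)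
    (hσ : σ.PosSemidef) (hsupp : powOnSupp 0 σ * ρ = ρ) {u : ℂ} (hu : u.re = 0) :
    ‖swivelFun U ρ σ (1 + 2 * u)‖ ^ 2 ≤ fidelity ρ (swiveledPetzMap σ (dilationMap U)
      (expLog (dilationMap U σ) u) (expLog σ (-u)) (dilationMap U ρ)) := by
  rw [swivelFun_one_add hρ hσ hsupp hu, swiveledPetzMap_eq U hρ]
  set B := swivelRoot U ρ σ (expLog (dilationMap U σ) u) (expLog σ (-u))
  obtain ⟨K, hK, hB⟩ := exists_contraction_mul_sqrt B
  unfold fidelity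
  gcongr
  set A := powOnSupp (1 / 2) ρ * powOnSupp (1 / 2) (Bᴴ * B) with hA
  have hC : ‖(swivelPhase U ρ u * K)ᴴ‖ ≤ 1 := by
    rw [Matrix.l2_opNorm_conjTranspose]
    exact l2_norm_mul_le_one (norm_swivelPhase_le hU ρ hu) hK
  refine le_trans (le_of_eq ?_) (norm_trace_mul_le_traceNorm A _ hC)
  rw [← norm_star (A * (swivelPhase U ρ u * K)ᴴ).trace, ← Matrix.trace_conjTranspose]
  congr 1
  conv_lhs => enter [1, 2, 2]; rw [hB]
  rw [Matrix.conjTranspose_mul, Matrix.conjTranspose_conjTranspose, hA, Matrix.conjTranspose_mul,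
    powOnSupp_conjTranspose, powOnSupp_conjTranspose, Matrix.trace_mul_comm (powOnSupp _ ρ)]
  simp only [Matrix.mul_assoc]

theorem trace_sqrt_mul_swivelPhase (hU : Uᴴ * U = 1) {ρ : Matrix h h ℂ} (hρ : IsDensity ρ)
    {u : ℂ} (hu : u.re = 0) :
    (powOnSupp (1 / 2) ρ * swivelPhase U ρ u *
      (powOnSupp (1 / 2) ρ * swivelPhase U ρ u)ᴴ).trace.re = 1 := by
  rw [Matrix.conjTranspose_mul, Matrix.mul_assoc, ← Matrix.mul_assoc (swivelPhase U ρ u),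
    swivelPhase_mul_conjTranspose hU ρ hu, Matrix.one_mul, powOnSupp_conjTranspose,
    powOnSupp_half_mul_self hρ.1, hρ.2, Complex.one_re]

/-- Since √ρ = ρ⁰√ρ, B may be replaced by Bρ⁰. Cauchy–Schwarz then applies, √ρ · phase having
Hilbert–Schmidt norm 1. -/
theorem norm_swivelFun_sq_le_trace (hU : Uᴴ * U = 1) {ρ σ : Matrix h h ℂ} (hρ : IsDensity ρ)
    (hσ : σ.PosSemidef) (hsupp : powOnSupp 0 σ * ρ = ρ) {u : ℂ} (hu : u.re = 0) :
    ‖swivelFun U ρ σ (1 + 2 * u)‖ ^ 2 ≤ (powOnSupp 0 ρ * swiveledPetzMap σ (dilationMap U)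
      (expLog (dilationMap U σ) u) (expLog σ (-u)) (dilationMap U ρ)).trace.re := by
  rw [swivelFun_one_add hρ.1 hσ hsupp hu, swiveledPetzMap_eq U hρ.1]
  set B := swivelRoot U ρ σ (expLog (dilationMap U σ) u) (expLog σ (-u))
  have h1 : (powOnSupp (1 / 2) ρ * (swivelPhase U ρ u * B)).trace =
      (powOnSupp (1 / 2) ρ * swivelPhase U ρ u * (B * powOnSupp 0 ρ)).trace := by
    rw [← powOnSupp_zero_mul_powOnSupp hρ.1 (1 / 2), Matrix.mul_assoc, Matrix.trace_mul_comm,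
      powOnSupp_zero_mul_powOnSupp hρ.1]
    simp only [Matrix.mul_assoc]
  rw [h1]
  refine (norm_trace_mul_sq_le _ _).trans (le_of_eq ?_)
  rw [trace_sqrt_mul_swivelPhase hU hρ hu, one_mul, Matrix.conjTranspose_mul,
    powOnSupp_conjTranspose, ← Matrix.mul_assoc, Matrix.trace_mul_comm, Matrix.mul_assoc,
    ← Matrix.mul_assoc, ← Matrix.mul_assoc, powOnSupp_mul_powOnSupp hρ.1, add_zero,
    Matrix.mul_assoc]

theorem expLog_add_of_posDef {n : Type*} [Fintype n] [DecidableEq n] {A : Matrix n n ℂ}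
    (hA : A.PosDef) (x : ℝ) (u : ℂ) : expLog A (x + u) = expLog A u * powOnSupp x A := by
  rw [← powOnSupp_zero_mul_expLog_add hA.posSemidef, powOnSupp_zero_of_posDef hA, Matrix.one_mul]

variable (U) in
/-- A square root of the inverse of the swiveled Petz recovery map. -/
noncomputable def swivelInvRoot (ρ σ : Matrix h h ℂ) (V : Matrix b b ℂ) (W : Matrix h h ℂ) :
    Matrix (b × e) h ℂ :=
  ampliation e (powOnSupp (-(1 / 2)) (dilationMap U ρ) * Vᴴ *
    powOnSupp (1 / 2) (dilationMap U σ)) * U * powOnSupp (-(1 / 2)) σ * Wᴴ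

theorem swivelFun_neg_one_add {ρ σ : Matrix h h ℂ} (hρ : ρ.PosDef) (hσ : σ.PosDef)
    (hNρ : (dilationMap U ρ).PosDef) (hNσ : (dilationMap U σ).PosDef) {u : ℂ} (hu : u.re = 0) :
    swivelFun U ρ σ (-1 + 2 * u) = (powOnSupp (1 / 2) ρ * swivelPhase U ρ u *
      (swivelInvRoot U ρ σ (expLog (dilationMap U σ) u) (expLog σ (-u)) * ρ)).trace := by
  have e1 : (1 / 2 : ℂ) * (-1 + 2 * u) = ((-(1 / 2) : ℝ) : ℂ) + u := by push_cast; ring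
  have e2 : (-(1 / 2) : ℂ) * (-1 + 2 * u) = ((1 / 2 : ℝ) : ℂ) + -u := by push_cast; ring
  unfold swivelFun dilationAdjoint swivelInvRoot swivelPhase
  rw [e1, e2, expLog_add_of_posDef hρ, expLog_add_of_posDef hσ, expLog_add_of_posDef hNρ,
    expLog_add_of_posDef hNσ, expLog_conjTranspose_of_re_eq_zero _ hu,
    expLog_conjTranspose_of_re_eq_zero _ (u := -u) (by simp [hu]), neg_neg,
    Matrix.trace_mul_comm, (commute_expLog_powOnSupp ρ _ _).eq,
    (commute_expLog_powOnSupp σ _ _).eq]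
  simp only [LinearMap.coe_mk, AddHom.coe_mk, map_mul, Matrix.mul_assoc]

theorem norm_swivelFun_sq_le_trace_inv (hU : Uᴴ * U = 1) {ρ σ : Matrix h h ℂ} (hρ : ρ.PosDef)
    (hρ1 : ρ.trace = 1) (hσ : σ.PosDef) (hNρ : (dilationMap U ρ).PosDef)
    (hNσ : (dilationMap U σ).PosDef) {u : ℂ} (hu : u.re = 0) :
    ‖swivelFun U ρ σ (-1 + 2 * u)‖ ^ 2 ≤ (ρ ^ 2 *
      ((swivelInvRoot U ρ σ (expLog (dilationMap U σ) u) (expLog σ (-u)))ᴴ *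
      swivelInvRoot U ρ σ (expLog (dilationMap U σ) u) (expLog σ (-u)))).trace.re := by
  rw [swivelFun_neg_one_add hρ hσ hNρ hNσ hu]
  refine (norm_trace_mul_sq_le _ _).trans (le_of_eq ?_)
  rw [trace_sqrt_mul_swivelPhase hU ⟨hρ.posSemidef, hρ1⟩ hu, one_mul, Matrix.conjTranspose_mul,
    hρ.isHermitian.eq, ← Matrix.mul_assoc, Matrix.trace_mul_comm, sq]
  simp only [Matrix.mul_assoc]

/-- With R = B†B and X the inverse root, BX† = 1 and B†X = 1, hence B†(BX†)X = 1. The first identity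
needs UU† = 1, so an isometry would not do. -/
theorem swiveledPetzMap_mul_swivelInvRoot (hU : Uᴴ * U = 1) (hU' : U * Uᴴ = 1)
    {ρ σ : Matrix h h ℂ} (hσ : σ.PosDef)
    (hNρ : (dilationMap U ρ).PosDef) (hNσ : (dilationMap U σ).PosDef) (hρ : ρ.PosSemidef)
    {V : Matrix b b ℂ} {W : Matrix h h ℂ} (hV : V ∈ Matrix.unitaryGroup b ℂ)
    (hW : W ∈ Matrix.unitaryGroup h ℂ) :
    swiveledPetzMap σ (dilationMap U) V W (dilationMap U ρ) *
      ((swivelInvRoot U ρ σ V W)ᴴ * swivelInvRoot U ρ σ V W) = 1 := by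
  have hV1 : V * Vᴴ = 1 := Matrix.mem_unitaryGroup_iff.mp hV
  have hV2 : Vᴴ * V = 1 := Matrix.mem_unitaryGroup_iff'.mp hV
  have hW1 : W * Wᴴ = 1 := Matrix.mem_unitaryGroup_iff.mp hW
  have hW2 : Wᴴ * W = 1 := Matrix.mem_unitaryGroup_iff'.mp hW
  have hNσ1 := powOnSupp_neg_mul_powOnSupp hNσ (1 / 2)
  have hNρ1 := powOnSupp_mul_powOnSupp_neg hNρ (1 / 2)
  have hσ1 := powOnSupp_mul_powOnSupp_neg hσ (1 / 2)
  have h1 : swivelRoot U ρ σ V W * (swivelInvRoot U ρ σ V W)ᴴ = 1 := by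
    calc _ = ampliation e (powOnSupp (1 / 2) (dilationMap U ρ) * Vᴴ *
          powOnSupp (-(1 / 2)) (dilationMap U σ)) * (U * (powOnSupp (1 / 2) σ * (Wᴴ * W) *
          powOnSupp (-(1 / 2)) σ) * Uᴴ) * ampliation e (powOnSupp (1 / 2) (dilationMap U σ) * V *
          powOnSupp (-(1 / 2)) (dilationMap U ρ)) := by
          simp only [swivelRoot, swivelInvRoot, Matrix.conjTranspose_mul, neg_div,
            Matrix.conjTranspose_conjTranspose, ampliation_conjTranspose, powOnSupp_conjTranspose,
            Matrix.mul_assoc]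
      _ = ampliation e (powOnSupp (1 / 2) (dilationMap U ρ) * (Vᴴ *
          (powOnSupp (-(1 / 2)) (dilationMap U σ) * powOnSupp (1 / 2) (dilationMap U σ)) * V) *
          powOnSupp (-(1 / 2)) (dilationMap U ρ)) := by
          rw [hW2, Matrix.mul_one, hσ1, Matrix.mul_one, hU', Matrix.mul_one, ← map_mul]
          simp only [Matrix.mul_assoc]
      _ = 1 := by rw [hNσ1, Matrix.mul_one, hV2, Matrix.mul_one, hNρ1, map_one]
  have h2 : (swivelRoot U ρ σ V W)ᴴ * swivelInvRoot U ρ σ V W = 1 := by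
    calc _ = W * (powOnSupp (1 / 2) σ * (Uᴴ * ampliation e (
          powOnSupp (-(1 / 2)) (dilationMap U σ) * (V * (powOnSupp (1 / 2) (dilationMap U ρ) *
          powOnSupp (-(1 / 2)) (dilationMap U ρ)) * Vᴴ) * powOnSupp (1 / 2) (dilationMap U σ)) *
          U) * powOnSupp (-(1 / 2)) σ) * Wᴴ := by
          simp only [swivelRoot, swivelInvRoot, Matrix.conjTranspose_mul, neg_div,
            Matrix.conjTranspose_conjTranspose, ampliation_conjTranspose, powOnSupp_conjTranspose,
            Matrix.mul_assoc, map_mul]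
      _ = 1 := by
          rw [hNρ1, Matrix.mul_one, hV1, Matrix.mul_one, hNσ1, map_one, Matrix.mul_one, hU,
            Matrix.mul_one, hσ1, Matrix.mul_one, hW1]
  rw [swiveledPetzMap_eq U hρ, Matrix.mul_assoc, ← Matrix.mul_assoc _ (swivelInvRoot U ρ σ V W)ᴴ,
    h1, Matrix.one_mul, h2]

end EdgeBounds

/-! ### From edge bounds to bounds on the entropy drop. -/

section EntropyBounds

variable {h b e : Type*} [Fintype h] [Fintype b] [Fintype e] [DecidableEq h] [DecidableEq b]
  [DecidableEq e] {U : Matrix (b × e) h ℂ}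

variable (U) in
/-- The decrease of the relative entropy under the channel, without support conditions. -/
noncomputable def entropyDrop (ρ σ : Matrix h h ℂ) : ℝ :=
  (ρ * (logOnSupp ρ - logOnSupp σ)).trace.re -
    (dilationMap U ρ * (logOnSupp (dilationMap U ρ) - logOnSupp (dilationMap U σ))).trace.re

theorem exp_neg_entropyDrop_le (hU : Uᴴ * U = 1) {ρ σ : Matrix h h ℂ} (hρ : IsDensity ρ) {M : ℝ}
    (hM : ∀ u : ℂ, u.re = 0 → ‖swivelFun U ρ σ (1 + 2 * u)‖ ^ 2 ≤ M) :
    Real.exp (-entropyDrop U ρ σ) ≤ M := by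
  obtain ⟨C, hC⟩ := exists_norm_swivelFun_le hU hρ.1 σ
  have hM0 : 0 ≤ M := (sq_nonneg _).trans (hM 0 rfl)
  -- The edge bound is on |f|², hence √M; squaring the conclusion cancels the factor 1/2 in f'(0).
  have key := exp_deriv_le_of_three_lines (b := √M) (differentiable_swivelFun U ρ σ)
    (fun z h0 h1 => hC z (abs_le.mpr ⟨by linarith, h1⟩))
    (fun z hz => norm_swivelFun_le_one hU hρ σ hz)
    (fun z hz => Real.le_sqrt_of_sq_le (by
      have := hM ((z - 1) / 2) (by simp [hz])
      rwa [mul_div_cancel₀ _ two_ne_zero, add_sub_cancel] at this))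
    (by rw [swivelFun_zero hU, hρ.2]) (hasDerivAt_swivelFun_zero hU ρ σ)
  have h2 := pow_le_pow_left₀ (Real.exp_nonneg _) key 2
  rw [Real.sq_sqrt hM0, ← Real.exp_nat_mul] at h2
  refine le_trans (le_of_eq (congrArg Real.exp ?_)) h2
  simp [entropyDrop, Complex.mul_re]

/-- The three lines argument for z ↦ f(-z), whose derivative at 0 has the opposite sign. -/
theorem exp_entropyDrop_le (hU : Uᴴ * U = 1) {ρ σ : Matrix h h ℂ} (hρ : IsDensity ρ) {M : ℝ}
    (hM : ∀ u : ℂ, u.re = 0 → ‖swivelFun U ρ σ (-1 + 2 * u)‖ ^ 2 ≤ M) :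
    Real.exp (entropyDrop U ρ σ) ≤ M := by
  obtain ⟨C, hC⟩ := exists_norm_swivelFun_le hU hρ.1 σ
  have hM0 : 0 ≤ M := (sq_nonneg _).trans (hM 0 rfl)
  have hd0 := hasDerivAt_swivelFun_zero hU ρ σ
  rw [← neg_zero] at hd0
  have hd := hd0.comp (0 : ℂ) (hasDerivAt_neg 0)
  have key := exp_deriv_le_of_three_lines (b := √M)
    ((differentiable_swivelFun U ρ σ).comp differentiable_neg)
    (fun z h0 h1 => hC (-z) (by rw [Complex.neg_re, abs_neg]; exact abs_le.mpr ⟨by linarith, h1⟩))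
    (fun z hz => norm_swivelFun_le_one hU hρ σ (by rw [Complex.neg_re, hz, neg_zero]))
    (fun z hz => Real.le_sqrt_of_sq_le (by
      have := hM ((1 - z) / 2) (by simp [hz])
      rwa [mul_div_cancel₀ _ two_ne_zero, add_sub, neg_add_cancel, zero_sub] at this))
    (by rw [Function.comp_apply, neg_zero, swivelFun_zero hU, hρ.2]) hd
  have h2 := pow_le_pow_left₀ (Real.exp_nonneg _) key 2
  rw [Real.sq_sqrt hM0, ← Real.exp_nat_mul] at h2
  refine le_trans (le_of_eq (congrArg Real.exp ?_)) h2
  simp [entropyDrop, Complex.mul_re]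

end EntropyBounds

/-! ### Inclusion of supports as an algebraic identity. -/

section Supports

variable {n : Type*} [Fintype n] [DecidableEq n]

theorem mulVec_mem_suppSpace {A : Matrix n n ℂ} (hA : A.IsHermitian) (x : n → ℂ) :
    A *ᵥ x ∈ suppSpace A := by
  have hx : x = ∑ i, hA.eigenvectorBasis.repr (WithLp.toLp 2 x) i •
      (hA.eigenvectorBasis i : n → ℂ) := by
    have h := congrArg (WithLp.ofLp) (hA.eigenvectorBasis.sum_repr (WithLp.toLp 2 x))
    simpa using h.symm
  rw [hx, Matrix.mulVec_sum]
  refine Submodule.sum_mem _ fun i _ => ?_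
  rw [Matrix.mulVec_smul, hA.mulVec_eigenvectorBasis]
  refine Submodule.smul_mem _ _ ?_
  by_cases h : hA.eigenvalues i = 0
  · simp [h]
  · rw [← Complex.coe_smul]
    refine Submodule.smul_mem _ _ (Submodule.subset_span ⟨hA.eigenvalues i, by exact_mod_cast h, ?_⟩)
    rw [hA.mulVec_eigenvectorBasis, Complex.coe_smul]

/-- The projection σ⁰ fixes supp σ, which contains the range of ρ. Conversely, if σ⁰ρ = ρ, an
eigenvector v of ρ with non-zero eigenvalue equals σ(σ⁻¹v). -/
theorem suppSpace_le_iff {ρ σ : Matrix n n ℂ} (hρ : ρ.IsHermitian) (hσ : σ.PosSemidef) :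
    suppSpace ρ ≤ suppSpace σ ↔ powOnSupp 0 σ * ρ = ρ := by
  constructor
  · intro h
    have hfix : ∀ v ∈ suppSpace σ, powOnSupp 0 σ *ᵥ v = v := by
      intro v hv
      induction hv using Submodule.span_induction with
      | mem v hv =>
        obtain ⟨a, ha, hv⟩ := hv
        have h1 : v = a⁻¹ • σ *ᵥ v := by rw [hv, inv_smul_smul₀ ha]
        rw [h1, Matrix.mulVec_smul, Matrix.mulVec_mulVec, powOnSupp_zero_mul_self hσ]
      | zero => simp
      | add x y _ _ hx hy => rw [Matrix.mulVec_add, hx, hy]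
      | smul c x _ hx => rw [Matrix.mulVec_smul, hx]
    refine Matrix.ext_of_mulVec_single fun i => ?_
    rw [← Matrix.mulVec_mulVec]
    exact hfix _ (h (mulVec_mem_suppSpace hρ _))
  · intro h
    refine Submodule.span_le.mpr ?_
    rintro v ⟨a, ha, hv⟩
    have h1 : v = σ *ᵥ (powOnSupp (-1) σ *ᵥ v) := by
      have h2 : v = a⁻¹ • ρ *ᵥ v := by rw [hv, inv_smul_smul₀ ha]
      have h3 : σ * powOnSupp (-1) σ = powOnSupp 0 σ := by
        conv_lhs => enter [1]; rw [← powOnSupp_one hσ]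
        rw [powOnSupp_mul_powOnSupp hσ, add_neg_cancel]
      rw [Matrix.mulVec_mulVec, h3]
      conv_rhs => rw [h2, Matrix.mulVec_smul, Matrix.mulVec_mulVec, h, hv, inv_smul_smul₀ ha]
    rw [h1]
    exact mulVec_mem_suppSpace hσ.isHermitian _

theorem suppSpace_le_of_posDef {ρ σ : Matrix n n ℂ} (hρ : ρ.IsHermitian) (hσ : σ.PosDef) :
    suppSpace ρ ≤ suppSpace σ := by
  rw [suppSpace_le_iff hρ hσ.posSemidef, powOnSupp_zero_of_posDef hσ, Matrix.one_mul]

/-- Since ρ = √σ(σ^{-1/2}ρ), the projection onto supp N(σ), tensored with 1, fixes Uρ; testing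
against every Y carries this to N(ρ). -/
theorem dilationMap_suppSpace_le {h b e : Type*} [Fintype h] [Fintype b] [Fintype e]
    [DecidableEq h] [DecidableEq b] [DecidableEq e] (U : Matrix (b × e) h ℂ) {ρ σ : Matrix h h ℂ}
    (hρ : ρ.PosSemidef) (hσ : σ.PosSemidef) (hle : suppSpace ρ ≤ suppSpace σ) :
    suppSpace (dilationMap U ρ) ≤ suppSpace (dilationMap U σ) := by
  rw [suppSpace_le_iff hρ.isHermitian hσ] at hle
  rw [suppSpace_le_iff (dilationMap_posSemidef U hρ).isHermitian (dilationMap_posSemidef U hσ)]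
  have h1 : ampliation e (powOnSupp 0 (dilationMap U σ)) * (U * ρ) = U * ρ := by
    have h2 : powOnSupp (1 / 2) σ * (powOnSupp (-(1 / 2)) σ * ρ) = ρ := by
      rw [← Matrix.mul_assoc, powOnSupp_mul_powOnSupp hσ, add_neg_cancel, hle]
    have h3 := congrArg (· * (powOnSupp (-(1 / 2)) σ * ρ)) (ampliation_supp_mul U σ hσ)
    simpa only [Matrix.mul_assoc, h2] using h3
  refine Matrix.ext_iff_trace_mul_left.mpr fun Y => ?_
  rw [← Matrix.mul_assoc, Matrix.trace_mul_comm, trace_dilationMap_mul, Matrix.trace_mul_comm,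
    map_mul, Matrix.mul_assoc, Matrix.mul_assoc, Matrix.mul_assoc, h1, Matrix.trace_mul_comm Y,
    trace_dilationMap_mul, Matrix.trace_mul_comm ρ]
  simp only [Matrix.mul_assoc]

end Supports

/-! ### Dilation of a channel. -/

section Stinespring

variable {n m : Type*} [Fintype n] [Fintype m] [DecidableEq n] [DecidableEq m]

/-- Stinespring's dilation theorem for quantum channels. -/
theorem IsChannel.exists_dilation {N : Matrix n n ℂ →ₗ[ℂ] Matrix m m ℂ} (hN : IsChannel N) :
    ∃ U : Matrix (m × (Fin (Fintype.card n) × m)) n ℂ, Uᴴ * U = 1 ∧ N = dilationMap U := by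
  let ε : n ≃ Fin (Fintype.card n) := Fintype.equivFin n
  -- The unnormalised maximally entangled vector; id ⊗ N sends its projector to the Choi matrix,
  -- whose factorisation B†B provides the Kraus operators.
  let v : Fin (Fintype.card n) × n → ℂ := fun p => if p.1 = ε p.2 then 1 else 0
  have hC := hN.completely_positive _ _ (Matrix.posSemidef_vecMulVec_self_star v)
  obtain ⟨B, hB⟩ := hC.exists_eq_conjTranspose_mul_self
  have hB' : ∀ i j a b, N (Matrix.single i j 1) a b =
      ∑ c, star (B c (ε i, a)) * B c (ε j, b) := by
    intro i j a b
    have h1 := congrFun (congrFun hB (ε i, a)) (ε j, b)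
    have h2 : (Matrix.of fun i' j' : n => Matrix.vecMulVec v (star v) (ε i, i') (ε j, j')) =
        Matrix.single i j (1 : ℂ) := by
      ext i' j'
      simp [Matrix.vecMulVec_apply, v, Matrix.single_apply, ite_and]
      split_ifs <;> rfl
    simpa [h2, Matrix.mul_apply] using h1
  let U : Matrix (m × (Fin (Fintype.card n) × m)) n ℂ :=
    Matrix.of fun p i => star (B p.2 (ε i, p.1))
  have hNU : N = dilationMap U := by
    refine Matrix.ext_linearMap _ fun i j => ?_
    refine LinearMap.ext_ring ?_
    ext a b
    simp only [LinearMap.coe_comp, Function.comp_apply, Matrix.singleLinearMap_apply]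
    rw [hB']
    simp [dilationMap, U, Matrix.mul_apply, Matrix.single_apply, ite_and]
  refine ⟨U, ?_, hNU⟩
  refine Matrix.ext_iff_trace_mul_left.mpr fun X => ?_
  -- Duality at Y = 1 turns trace preservation into U†U = 1.
  have h1 := trace_dilationMap_mul U X 1
  rw [← hNU, Matrix.mul_one, hN.trace_preserving, map_one, Matrix.mul_one] at h1
  rw [Matrix.mul_one, h1]

end Stinespring

/-! ### Compactness of the swivels and continuity. -/

section Attainment

variable {n m : Type*} [Fintype n] [Fintype m] [DecidableEq n] [DecidableEq m]

theorem isCompact_commutingUnitaries (ω : Matrix n n ℂ) : IsCompact (commutingUnitaries ω) := by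
  have : ProperSpace (Matrix n n ℂ) := FiniteDimensional.proper ℂ _
  refine Metric.isCompact_of_isClosed_isBounded ?_ ?_
  · have h : commutingUnitaries ω = {V | V * Vᴴ = 1} ∩ {V | V * ω = ω * V} := by
      ext V
      exact and_congr Matrix.mem_unitaryGroup_iff Iff.rfl
    rw [h]
    exact (isClosed_eq (by fun_prop) (by fun_prop)).inter (isClosed_eq (by fun_prop) (by fun_prop))
  · exact (Metric.isBounded_closedBall (x := (0 : Matrix n n ℂ)) (r := 1)).subset fun V hV => by
      simpa using l2_norm_le_one_of_unitary hV.1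

theorem one_mem_commutingUnitaries (ω : Matrix n n ℂ) :
    (1 : Matrix n n ℂ) ∈ commutingUnitaries ω :=
  ⟨one_mem _, Commute.one_left ω⟩

variable {α : Type*} [TopologicalSpace α] {d : Matrix n n ℂ → Matrix n n ℂ → α}
  {ρ σ : Matrix n n ℂ} {N : Matrix n n ℂ →ₗ[ℂ] Matrix m m ℂ}

/-- `f` need agree with `d` only on the commuting unitaries: this lets inverses of R be replaced by
expressions continuous in all (V, W). -/
theorem isCompact_swivelValues {f : Matrix m m ℂ × Matrix n n ℂ → α} (hf : Continuous f)
    (hfd : ∀ V ∈ commutingUnitaries (N σ), ∀ W ∈ commutingUnitaries σ,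
      d ρ (swiveledPetzMap σ N V W (N ρ)) = f (V, W)) : IsCompact (swivelValues d ρ σ N) := by
  have h : swivelValues d ρ σ N = f '' (commutingUnitaries (N σ) ×ˢ commutingUnitaries σ) := by
    ext x
    constructor
    · rintro ⟨V, hV, W, hW, rfl⟩
      exact ⟨(V, W), ⟨hV, hW⟩, (hfd V hV W hW).symm⟩
    · rintro ⟨⟨V, W⟩, ⟨hV, hW⟩, rfl⟩
      exact ⟨V, hV, W, hW, (hfd V hV W hW).symm⟩
  rw [h]
  exact ((isCompact_commutingUnitaries _).prod (isCompact_commutingUnitaries _)).image hf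

omit [TopologicalSpace α] in
theorem swivelValues_nonempty : (swivelValues d ρ σ N).Nonempty :=
  ⟨_, 1, one_mem_commutingUnitaries _, 1, one_mem_commutingUnitaries _, rfl⟩

theorem continuous_powOnSupp_half {X : Type*} [TopologicalSpace X] {a : X → Matrix n n ℂ}
    (ha : Continuous a) (h : ∀ x, (a x).PosSemidef) :
    Continuous fun x => powOnSupp (1 / 2) (a x) := by
  have h1 : ∀ x, powOnSupp (1 / 2) (a x) = cfc Real.sqrt (a x) := fun x => by
    refine cfc_congr fun y _ => ?_
    by_cases hy : y = 0 <;> simp [hy, Real.sqrt_eq_rpow]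
  simp only [h1]
  exact Continuous.cfc_of_mem_nhdsSet (s := Set.univ) Real.sqrt Filter.univ_mem ha
    (fun x => (h x).isHermitian.isSelfAdjoint) Real.continuous_sqrt.continuousOn

theorem continuous_fidelity {X : Type*} [TopologicalSpace X] (ρ : Matrix n n ℂ)
    {a : X → Matrix n n ℂ} (ha : Continuous a) (h : ∀ x, (a x).PosSemidef) :
    Continuous fun x => fidelity ρ (a x) := by
  unfold fidelity traceNorm
  have h1 : Continuous fun x => powOnSupp (1 / 2) ρ * powOnSupp (1 / 2) (a x) :=
    continuous_const.mul (continuous_powOnSupp_half ha h)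
  have h2 := continuous_powOnSupp_half (h1.matrix_conjTranspose.mul h1)
    fun x => Matrix.posSemidef_conjTranspose_mul_self _
  exact (Complex.continuous_re.comp h2.matrix_trace).pow 2

theorem continuous_elog : Continuous elog :=
  ENNReal.continuous_log.comp ENNReal.continuous_ofReal

theorem elog_mono {x y : ℝ} (h : x ≤ y) : elog x ≤ elog y :=
  ENNReal.log_le_log (ENNReal.ofReal_le_ofReal h)

theorem elog_exp (x : ℝ) : elog (Real.exp x) = x := by
  rw [elog, ENNReal.log_ofReal_of_pos (Real.exp_pos x), Real.log_exp]

variable {b e : Type*} [Fintype b] [Fintype e] [DecidableEq b] [DecidableEq e]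

theorem continuous_ampliation : Continuous (ampliation e : Matrix b b ℂ → _) :=
  (ampliation e : Matrix b b ℂ →⋆ₐ[ℂ] _).toAlgHom.toLinearMap.continuous_of_finiteDimensional

theorem continuous_swivelRoot (U : Matrix (b × e) n ℂ) (ρ σ : Matrix n n ℂ) :
    Continuous fun p : Matrix b b ℂ × Matrix n n ℂ => swivelRoot U ρ σ p.1 p.2 := by
  unfold swivelRoot
  have h : Continuous fun p : Matrix b b ℂ × Matrix n n ℂ =>
      powOnSupp (1 / 2) (dilationMap U ρ) * p.1ᴴ * powOnSupp (-1 / 2) (dilationMap U σ) := by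
    fun_prop
  exact (((continuous_ampliation.comp h).matrix_mul continuous_const).matrix_mul
    continuous_const).matrix_mul continuous_snd.matrix_conjTranspose

theorem continuous_swivelInvRoot (U : Matrix (b × e) n ℂ) (ρ σ : Matrix n n ℂ) :
    Continuous fun p : Matrix b b ℂ × Matrix n n ℂ => swivelInvRoot U ρ σ p.1 p.2 := by
  unfold swivelInvRoot
  have h : Continuous fun p : Matrix b b ℂ × Matrix n n ℂ =>
      powOnSupp (-(1 / 2)) (dilationMap U ρ) * p.1ᴴ * powOnSupp (1 / 2) (dilationMap U σ) := by
    fun_prop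
  exact (((continuous_ampliation.comp h).matrix_mul continuous_const).matrix_mul
    continuous_const).matrix_mul continuous_snd.matrix_conjTranspose

end Attainment

/-! ### The four recovery inequalities. -/

section RecoveryBounds

variable {h b e : Type*} [Fintype h] [Fintype b] [Fintype e] [DecidableEq h] [DecidableEq b]
  [DecidableEq e] {U : Matrix (b × e) h ℂ} {ρ σ : Matrix h h ℂ}

theorem relEntropy_sub_relEntropy (hρ : ρ.PosSemidef) (hσ : σ.PosSemidef)
    (hle : suppSpace ρ ≤ suppSpace σ) :
    relEntropy ρ σ - relEntropy (dilationMap U ρ) (dilationMap U σ) = entropyDrop U ρ σ := by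
  rw [relEntropy, relEntropy, if_pos hle, if_pos (dilationMap_suppSpace_le U hρ hσ hle),
    ← EReal.coe_sub, entropyDrop]

theorem exists_isGreatest_fidelity (hU : Uᴴ * U = 1) (hρ : IsDensity ρ) (hσ : σ.PosSemidef)
    (hle : suppSpace ρ ≤ suppSpace σ) :
    ∃ F : ℝ, IsGreatest (swivelValues fidelity ρ σ (dilationMap U)) F ∧
      -elog F ≤ relEntropy ρ σ - relEntropy (dilationMap U ρ) (dilationMap U σ) := by
  have hB := continuous_swivelRoot U ρ σ
  have hcont := continuous_fidelity ρ (hB.matrix_conjTranspose.matrix_mul hB)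
    fun _ => Matrix.posSemidef_conjTranspose_mul_self _
  obtain ⟨F, hF⟩ := (isCompact_swivelValues (d := fidelity) hcont fun V _ W _ => by
    rw [swiveledPetzMap_eq U hρ.1]).exists_isGreatest swivelValues_nonempty
  refine ⟨F, hF, ?_⟩
  rw [relEntropy_sub_relEntropy hρ.1 hσ hle, EReal.neg_le, ← EReal.coe_neg, ← elog_exp]
  have hsupp := (suppSpace_le_iff hρ.1.isHermitian hσ).mp hle
  have hNσ := (dilationMap_posSemidef U hσ).isHermitian
  exact elog_mono (exp_neg_entropyDrop_le hU hρ fun u hu =>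
    (norm_swivelFun_sq_le_fidelity hU hρ.1 hσ hsupp hu).trans
      (hF.2 ⟨_, expLog_mem_commutingUnitaries hNσ hu, _,
        expLog_mem_commutingUnitaries hσ.isHermitian (by simp [hu]), rfl⟩))

theorem exists_isLeast_relEntropyZero (hU : Uᴴ * U = 1) (hρ : IsDensity ρ) (hσ : σ.PosSemidef)
    (hle : suppSpace ρ ≤ suppSpace σ) :
    ∃ d : EReal, IsLeast (swivelValues relEntropyZero ρ σ (dilationMap U)) d ∧
      d ≤ relEntropy ρ σ - relEntropy (dilationMap U ρ) (dilationMap U σ) := by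
  have hB := continuous_swivelRoot U ρ σ
  have hR := hB.matrix_conjTranspose.matrix_mul hB
  have htr : Continuous fun p : Matrix b b ℂ × Matrix h h ℂ =>
      (powOnSupp 0 ρ * ((swivelRoot U ρ σ p.1 p.2)ᴴ * swivelRoot U ρ σ p.1 p.2)).trace.re :=
    Complex.continuous_re.comp (continuous_const.matrix_mul hR).matrix_trace
  obtain ⟨d, hd⟩ := (isCompact_swivelValues (d := relEntropyZero)
    (continuous_neg.comp (continuous_elog.comp htr)) fun V _ W _ => by
      rw [swiveledPetzMap_eq U hρ.1]; rfl).exists_isLeast swivelValues_nonempty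
  refine ⟨d, hd, ?_⟩
  rw [relEntropy_sub_relEntropy hρ.1 hσ hle]
  -- The three lines bound must be a real constant uniform in u, so the trace itself is maximised;
  -- its maximiser is then compared with `d`.
  obtain ⟨M, hM⟩ := (isCompact_swivelValues
    (d := fun ρ R : Matrix h h ℂ => (powOnSupp 0 ρ * R).trace.re) htr fun V _ W _ => by
      rw [swiveledPetzMap_eq U hρ.1]).exists_isGreatest swivelValues_nonempty
  have hsupp := (suppSpace_le_iff hρ.1.isHermitian hσ).mp hle
  have hNσ := (dilationMap_posSemidef U hσ).isHermitian
  have hexp := exp_neg_entropyDrop_le hU hρ fun u hu =>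
    (norm_swivelFun_sq_le_trace hU hρ hσ hsupp hu).trans
      (hM.2 ⟨_, expLog_mem_commutingUnitaries hNσ hu, _,
        expLog_mem_commutingUnitaries hσ.isHermitian (by simp [hu]), rfl⟩)
  obtain ⟨V, hV, W, hW, hMVW⟩ := hM.1
  dsimp only at hMVW
  refine (hd.2 ⟨V, hV, W, hW, rfl⟩).trans ?_
  rw [relEntropyZero, ← hMVW, EReal.neg_le, ← EReal.coe_neg, ← elog_exp]
  exact elog_mono hexp

theorem swiveledPetzMap_posDef (hU : Uᴴ * U = 1) (hU' : U * Uᴴ = 1) (hρ : ρ.PosSemidef)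
    (hσ : σ.PosDef) (hNρ : (dilationMap U ρ).PosDef) (hNσ : (dilationMap U σ).PosDef)
    {V : Matrix b b ℂ} {W : Matrix h h ℂ} (hV : V ∈ Matrix.unitaryGroup b ℂ)
    (hW : W ∈ Matrix.unitaryGroup h ℂ) :
    (swiveledPetzMap σ (dilationMap U) V W (dilationMap U ρ)).PosDef := by
  have hR : (swiveledPetzMap σ (dilationMap U) V W (dilationMap U ρ)).PosSemidef := by
    rw [swiveledPetzMap_eq U hρ]
    exact Matrix.posSemidef_conjTranspose_mul_self _
  refine hR.posDef_iff_isUnit.mpr ?_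
  exact IsUnit.of_mul_eq_one _
    (swiveledPetzMap_mul_swivelInvRoot hU hU' hσ hNρ hNσ hρ hV hW)

theorem swiveledPetzMap_inv (hU : Uᴴ * U = 1) (hU' : U * Uᴴ = 1) (hρ : ρ.PosSemidef)
    (hσ : σ.PosDef) (hNρ : (dilationMap U ρ).PosDef) (hNσ : (dilationMap U σ).PosDef)
    {V : Matrix b b ℂ} {W : Matrix h h ℂ} (hV : V ∈ Matrix.unitaryGroup b ℂ)
    (hW : W ∈ Matrix.unitaryGroup h ℂ) :
    (swiveledPetzMap σ (dilationMap U) V W (dilationMap U ρ))⁻¹ =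
      (swivelInvRoot U ρ σ V W)ᴴ * swivelInvRoot U ρ σ V W :=
  Matrix.inv_eq_right_inv (swiveledPetzMap_mul_swivelInvRoot hU hU' hσ hNρ hNσ hρ hV hW)

theorem relEntropyTwo_of_posDef {R : Matrix h h ℂ} (hρ : ρ.IsHermitian) (hR : R.PosDef) :
    relEntropyTwo ρ R = elog (ρ ^ 2 * R⁻¹).trace.re := by
  rw [relEntropyTwo, if_pos (suppSpace_le_of_posDef hρ hR), powOnSupp_neg_one_of_posDef hR]

/-- Both norms are squares, of √ρR^{-1/2} and of its adjoint. The new form involves only R⁻¹, which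
is explicit in (V, W). -/
theorem relEntropyMax_of_posDef {R : Matrix h h ℂ} (hρ : ρ.PosSemidef) (hR : R.PosDef) :
    relEntropyMax ρ R = elog ‖powOnSupp (1 / 2) ρ * R⁻¹ * powOnSupp (1 / 2) ρ‖ := by
  rw [relEntropyMax, if_pos (suppSpace_le_of_posDef hρ.isHermitian hR), ← Matrix.cstar_norm_def]
  set T := powOnSupp (-1 / 2) R with hT
  set S := powOnSupp (1 / 2) ρ with hS
  have hTT : T * T = R⁻¹ := by
    rw [hT, powOnSupp_mul_powOnSupp hR.posSemidef, ← powOnSupp_neg_one_of_posDef hR]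
    norm_num
  have hSS : S * S = ρ := powOnSupp_half_mul_self hρ
  have hTs : Tᴴ = T := powOnSupp_conjTranspose _ _
  have hSs : Sᴴ = S := powOnSupp_conjTranspose _ _
  have h1 : T * ρ * T = (S * T)ᴴ * (S * T) := by
    rw [Matrix.conjTranspose_mul, hTs, hSs, ← hSS]
    simp only [Matrix.mul_assoc]
  have h2 : S * R⁻¹ * S = (T * S)ᴴ * (T * S) := by
    rw [Matrix.conjTranspose_mul, hTs, hSs, ← hTT]
    simp only [Matrix.mul_assoc]
  have h3 : T * S = (S * T)ᴴ := by rw [Matrix.conjTranspose_mul, hTs, hSs]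
  rw [h1, h2, Matrix.l2_opNorm_conjTranspose_mul_self, Matrix.l2_opNorm_conjTranspose_mul_self, h3,
    Matrix.l2_opNorm_conjTranspose]

/-- Tr{ρ²X} = Tr{ρ(√ρX√ρ)}, an average against a state. With X = R⁻¹ this is D_2 ≤ D_max. -/
theorem trace_sq_mul_le (hρ : IsDensity ρ) (X : Matrix h h ℂ) :
    (ρ ^ 2 * X).trace.re ≤ ‖powOnSupp (1 / 2) ρ * X * powOnSupp (1 / 2) ρ‖ := by
  set S := powOnSupp (1 / 2) ρ with hS
  have hSS : S * S = ρ := powOnSupp_half_mul_self hρ.1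
  have h1 : (ρ ^ 2 * X).trace = (ρ * (S * X * S)).trace := by
    rw [← Matrix.mul_assoc ρ, Matrix.trace_mul_comm _ S, sq, ← hSS]
    simp only [Matrix.mul_assoc]
  have h2 := norm_trace_mul_le hρ.1 (S * X * S)
  rw [hρ.2, Complex.one_re, mul_one] at h2
  rw [h1]
  exact (Complex.re_le_norm _).trans h2

theorem exists_isGreatest_relEntropyTwo (hU : Uᴴ * U = 1) (hU' : U * Uᴴ = 1) (hρ : ρ.PosDef)
    (hρ1 : ρ.trace = 1) (hσ : σ.PosDef) (hNρ : (dilationMap U ρ).PosDef)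
    (hNσ : (dilationMap U σ).PosDef) :
    ∃ d : EReal, IsGreatest (swivelValues relEntropyTwo ρ σ (dilationMap U)) d ∧
      relEntropy ρ σ - relEntropy (dilationMap U ρ) (dilationMap U σ) ≤ d := by
  have hB := continuous_swivelInvRoot U ρ σ
  have htr : Continuous fun p : Matrix b b ℂ × Matrix h h ℂ =>
      (ρ ^ 2 * ((swivelInvRoot U ρ σ p.1 p.2)ᴴ * swivelInvRoot U ρ σ p.1 p.2)).trace.re :=
    Complex.continuous_re.comp
      (continuous_const.matrix_mul (hB.matrix_conjTranspose.matrix_mul hB)).matrix_trace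
  have hval : ∀ V ∈ commutingUnitaries (dilationMap U σ), ∀ W ∈ commutingUnitaries σ,
      (ρ ^ 2 * ((swivelInvRoot U ρ σ V W)ᴴ * swivelInvRoot U ρ σ V W)) =
      (ρ ^ 2 * (swiveledPetzMap σ (dilationMap U) V W (dilationMap U ρ))⁻¹) :=
    fun V hV W hW => by rw [swiveledPetzMap_inv hU hU' hρ.posSemidef hσ hNρ hNσ hV.1 hW.1]
  obtain ⟨d, hd⟩ := (isCompact_swivelValues (d := relEntropyTwo)
    (continuous_elog.comp htr) fun V hV W hW => by
      rw [relEntropyTwo_of_posDef hρ.isHermitian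
        (swiveledPetzMap_posDef hU hU' hρ.posSemidef hσ hNρ hNσ hV.1 hW.1), ← hval V hV W hW]
      rfl).exists_isGreatest swivelValues_nonempty
  refine ⟨d, hd, ?_⟩
  obtain ⟨M, hM⟩ := (isCompact_swivelValues
    (d := fun ρ R : Matrix h h ℂ => (ρ ^ 2 * R⁻¹).trace.re) htr fun V hV W hW => by
      rw [← hval V hV W hW]).exists_isGreatest swivelValues_nonempty
  rw [relEntropy_sub_relEntropy hρ.posSemidef hσ.posSemidef
    (suppSpace_le_of_posDef hρ.isHermitian hσ), ← elog_exp]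
  have hexp := exp_entropyDrop_le hU ⟨hρ.posSemidef, hρ1⟩ fun u hu =>
    (norm_swivelFun_sq_le_trace_inv hU hρ hρ1 hσ hNρ hNσ hu).trans
      (hM.2 ⟨_, expLog_mem_commutingUnitaries hNσ.isHermitian hu, _,
        expLog_mem_commutingUnitaries hσ.isHermitian (z := -u) (by simp [hu]), by
          rw [hval _ (expLog_mem_commutingUnitaries hNσ.isHermitian hu) _
            (expLog_mem_commutingUnitaries hσ.isHermitian (z := -u) (by simp [hu]))]⟩)
  obtain ⟨V, hV, W, hW, hMVW⟩ := hM.1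
  dsimp only at hMVW
  refine le_trans ?_ (hd.2 ⟨V, hV, W, hW, rfl⟩)
  rw [relEntropyTwo_of_posDef hρ.isHermitian
    (swiveledPetzMap_posDef hU hU' hρ.posSemidef hσ hNρ hNσ hV.1 hW.1), ← hMVW]
  exact elog_mono hexp

theorem exists_isGreatest_relEntropyMax (hU : Uᴴ * U = 1) (hU' : U * Uᴴ = 1) (hρ : ρ.PosDef)
    (hρ1 : ρ.trace = 1) (hσ : σ.PosDef) (hNρ : (dilationMap U ρ).PosDef)
    (hNσ : (dilationMap U σ).PosDef) :
    ∃ d : EReal, IsGreatest (swivelValues relEntropyMax ρ σ (dilationMap U)) d ∧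
      relEntropy ρ σ - relEntropy (dilationMap U ρ) (dilationMap U σ) ≤ d := by
  have hB := continuous_swivelInvRoot U ρ σ
  have hnorm : Continuous fun p : Matrix b b ℂ × Matrix h h ℂ =>
      ‖powOnSupp (1 / 2) ρ * ((swivelInvRoot U ρ σ p.1 p.2)ᴴ * swivelInvRoot U ρ σ p.1 p.2) *
        powOnSupp (1 / 2) ρ‖ :=
    ((continuous_const.matrix_mul (hB.matrix_conjTranspose.matrix_mul hB)).matrix_mul
      continuous_const).norm
  obtain ⟨d, hd⟩ := (isCompact_swivelValues (d := relEntropyMax)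
    (continuous_elog.comp hnorm) fun V hV W hW => by
      rw [relEntropyMax_of_posDef hρ.posSemidef
        (swiveledPetzMap_posDef hU hU' hρ.posSemidef hσ hNρ hNσ hV.1 hW.1),
        swiveledPetzMap_inv hU hU' hρ.posSemidef hσ hNρ hNσ hV.1 hW.1]
      rfl).exists_isGreatest swivelValues_nonempty
  refine ⟨d, hd, ?_⟩
  obtain ⟨d', hd', hle⟩ := exists_isGreatest_relEntropyTwo hU hU' hρ hρ1 hσ hNρ hNσ
  refine hle.trans ?_
  -- D_2 and D_max are compared at the pair that maximises D_2.
  obtain ⟨V, hV, W, hW, hVW⟩ := hd'.1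
  refine le_trans ?_ (hd.2 ⟨V, hV, W, hW, rfl⟩)
  have hR := swiveledPetzMap_posDef hU hU' hρ.posSemidef hσ hNρ hNσ hV.1 hW.1
  rw [hVW, relEntropyTwo_of_posDef hρ.isHermitian hR, relEntropyMax_of_posDef hρ.posSemidef hR]
  exact elog_mono (trace_sq_mul_le ⟨hρ.posSemidef, hρ1⟩ _)

end RecoveryBounds

end SwiveledRenyi

theorem mainTheorem4 :
    (∀ (n m : Type*) [Fintype n] [Fintype m] [DecidableEq n] [DecidableEq m]
      (ρ σ : Matrix n n ℂ) (N : Matrix n n ℂ →ₗ[ℂ] Matrix m m ℂ),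
      IsDensity ρ → σ.PosSemidef → σ ≠ 0 → IsChannel N → suppSpace ρ ≤ suppSpace σ →
      (∃ F : ℝ, IsGreatest (swivelValues fidelity ρ σ N) F ∧
        -elog F ≤ relEntropy ρ σ - relEntropy (N ρ) (N σ)) ∧
      (∃ d : EReal, IsLeast (swivelValues relEntropyZero ρ σ N) d ∧
        d ≤ relEntropy ρ σ - relEntropy (N ρ) (N σ))) ∧
    (∀ (s e' b e : Type*) [Fintype s] [Fintype e'] [Fintype b] [Fintype e]
      [DecidableEq s] [DecidableEq e'] [DecidableEq b] [DecidableEq e]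
      (ρ σ : Matrix (s × e') (s × e') ℂ) (U : Matrix (b × e) (s × e') ℂ)
      (N : Matrix (s × e') (s × e') ℂ →ₗ[ℂ] Matrix b b ℂ),
      ρ.PosDef → ρ.trace = 1 → σ.PosDef →
      U.conjTranspose * U = 1 → U * U.conjTranspose = 1 → N = dilationMap U →
      (N ρ).PosDef → (N σ).PosDef →
      (∃ d : EReal, IsGreatest (swivelValues relEntropyMax ρ σ N) d ∧
        relEntropy ρ σ - relEntropy (N ρ) (N σ) ≤ d) ∧
      (∃ d : EReal, IsGreatest (swivelValues relEntropyTwo ρ σ N) d ∧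
        relEntropy ρ σ - relEntropy (N ρ) (N σ) ≤ d)) := by
  refine ⟨?_, ?_⟩
  · intro n m _ _ _ _ ρ σ N hρ hσ _ hN hle
    obtain ⟨U, hU, rfl⟩ := hN.exists_dilation
    exact ⟨exists_isGreatest_fidelity hU hρ hσ hle, exists_isLeast_relEntropyZero hU hρ hσ hle⟩
  · intro s e' b e _ _ _ _ _ _ _ _ ρ σ U N hρ hρ1 hσ hU hU' hN hNρ hNσ
    subst hN
    exact ⟨exists_isGreatest_relEntropyMax hU hU' hρ hρ1 hσ hNρ hNσ,
      exists_isGreatest_relEntropyTwo hU hU' hρ hρ1 hσ hNρ hNσ⟩
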